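/- **Conventions.** $C_L=\{1,\dots,L\}$, $-C_L=\{-L,\dots,-1\}$. For a finite ordered partition $\mathscr P=\{P_a\}$ of a probability space $(X,\mu)$, a $\mathbb Z$-action $T$ and a finite $F\subset\mathbb Z$, the $(T,\mathscr P,F)$-name of $x$ is the family $(a_k)_{k\in F}$ with $T^kx\in P_{a_k}$; its distribution is within $\epsilon$ of that of $\mathscr P$ if $\bigl|\mu(P_a)-|\{k\in F: a_k=a\}|/|F|\bigr|<\epsilon$ for all $a$. A pair $(C_M,B)$ is an $\epsilon$-tower of $T$ if $T^1B,\dots,T^MB$ are pairwise disjoint and the complement of their union has measure less than $\epsilon$. The atoms of the pure partition of $B$ relative to $\mathscr P$ are the sets of points of $B$ with a common $(T,\mathscr P,C_M)$-name. $T$ is $\delta$-mixing relative to $(\ell,\mathscr P)$ if $|\mu(P\cap T^{-\ell}P')-\mu(P)\mu(P')|<\delta$ for all $P,P'\in\mathscr P$. **The construction.** Let $S$ be an ergodic measure-preserving automorphism of a standard atomless probability space $(X,\mu)$, let $\mathscr P_1,\mathscr P_2,\dots$ be finite measurable partitions, each refined by the next, which together generate the $\sigma$-algebra modulo null sets, and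 let $(\epsilon_n)_{n\ge1}$ be strictly decreasing with $0<\epsilon_n<2^{-n}$. Put $S_0=S$. Choose $K_1\ge1$, put $K_{n+1}=K_n+1$, and choose integers $L_n,M_n\ge 1$, measurable sets $B_n,E_n\subset X$, permutations and indices $1=n_1<n_2<\cdots$, as follows. *Form of each stage $n\ge1$.* $L_n>K_n$ and $L_n\mid M_n$; $(C_{M_n},B_n)$ is a tower of $S_{n-1}$; for each $1\le k\le K_n$, $\pi_k$ is a permutation of $C_{L_n}$ with $\pi_k(r)=r+k$ for $1\le r\le L_n-K_n$. Let $\Sigma_n$ be the set of the $K_n^{M_n/L_n}$ permutations of $C_{M_n}$ that act on each block $qL_n+C_{L_n}$, $0\le q<M_n/L_n$, as the translate of some $\pi_{k}$, with $1\le k\le K_n$ chosen separately for each block. Let $\sigma_n:B_n\to\Sigma_n$ be measurable. For $x\in X$ let $\pi_x$ be the bijection of $\mathbb Z$ given by $\pi_x(v)=v+\sigma_n(b)(p)-p$ if $S_{n-1}^vx=S_{n-1}^pb$ with $b\in B_n$, $p\in C_{M_n}$, and $\pi_x(v)=v$ if $S_{n-1}^vx$ is not in the tower; put $\beta_n(x,g)=\pi_x(g)-\pi_x(0)$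 and $S_n=S_{n-1}^{\beta_n^{-1}}$, that is, $S_n^g(x)=S_{n-1}^{h}(x)$ where $\beta_n(x,h)=g$. *Stage 1.* $\mu(X\setminus E_1)<\epsilon_1$, and every $x\in E_1$ has an $(S,\mathscr P_1,C_{K_1})$-name with distribution within $\epsilon_1$ of that of $\mathscr P_1$; $L_1>K_1/\epsilon_1$; $M_1>L_1/\epsilon_1$; $(C_{M_1},B_1)$ is an $\epsilon_1$-tower of $S$; for every $b\in B_1$ more than $(1-\epsilon_1)M_1$ of the $k\in C_{M_1}$ satisfy $S^kb\in E_1$; and $\sigma_1$ is uniformly distributed on $\Sigma_1$ over each atom of the pure partition of $B_1$ relative to $\mathscr P_1$. *Distinguished stages.* For $j\ge1$, $n_{j+1}$ is the least integer greater than $n_j$ for which there is a measurable set $E_{j+1}$ with $\mu(X\setminus E_{j+1})<\epsilon_{j+1}$ such that the $(S_{n_j},\mathscr P_{j+1},-C_{K_{n_{j+1}}})$-name of each of its points has distribution within $\epsilon_{j+1}$ of that of $\mathscr P_{j+1}$; fix such a set $E_{j+1}$. *Stage $n+1$, where $n\ge1$ and $n_j<n+1\le n_{j+1}$.* $K_{n_{j+1}}^3/L_{n+1}<\epsilon_{n+1}$;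 $\bigl(n+\sum_{i=1}^nL_i\bigr)/(L_{n+1}-K_{n+1})<\epsilon_{n+1}$; $M_{n+1}>L_{n+1}/\epsilon_{n+1}$; $M_{n+1}>M_n$; $(C_{M_{n+1}},B_{n+1})$ is an $\epsilon_{n+1}/K_{n_{j+1}}^2$-tower of $S_n$. If moreover $n+1=n_{j+1}$, put $O_j=\{x:S_{n_j}(x)=S_n(x)\}$ and require: for every $b\in B_{n+1}$, more than $(1-\epsilon_{j+1})M_{n+1}$ of the $k\in C_{M_{n+1}}$ satisfy $S_n^kb\in E_{j+1}$; for every $b\in B_{n+1}$ the $(S_n,\{O_j,X\setminus O_j\},C_{M_{n+1}})$-name of $b$ has distribution within $\epsilon_{n+1}/K_{n+1}$ of that of $\{O_j,X\setminus O_j\}$; and $\sigma_{n+1}$ is uniformly distributed on $\Sigma_{n+1}$ over each atom of the pure partition of $B_{n+1}$ relative to $\mathscr P_{j+1}\vee\{O_j,X\setminus O_j\}$. **Proposition.** For all choices made according to this construction, put $\ell_i=L_{n_i}$. Then there is a sequence $(\delta_i)$ of non-negative real numbers with $\lim_{i\to\infty}\delta_i=0$ such that, for every $i>1$ and every $j\ge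 i$, the action $S_{n_j}$ is $\delta_i$-mixing relative to $(\ell_i,\mathscr P_i)$. -/

import Mathlib

open MeasureTheory Filter Topology

namespace Staggered

/-! Actions of `ℤ` on `X` are written `T : ℤ → X → X`, with `T g x` for `T^g(x)`.  A finite ordered
partition of `X` is given by its label map `f : X → ι`; its cells are the sets `f ⁻¹' {i}`.
For natural numbers `L` the interval `C_L = {1, …, L}` is `Finset.Icc (1 : ℤ) L`, and
`-C_L = {-L, …, -1}` is `Finset.Icc (-(L : ℤ)) (-1)`. -/

open Classical in
/-- The frequency of the label `i` in the `(T, f, F)`-name `(f (T^k x))_{k ∈ F}` of `x`. -/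
noncomputable def nameFreq {X ι : Type*} (T : ℤ → X → X) (f : X → ι) (F : Finset ℤ) (x : X)
    (i : ι) : ℝ :=
  ((F.filter fun k => f (T k x) = i).card : ℝ) / (F.card : ℝ)

/-- The distribution of the `(T, f, F)`-name of `x` is within `ε` of the distribution of the
partition `f` of the probability space. -/
def NameWithin {X ι : Type*} [MeasurableSpace X] (μ : Measure X) (T : ℤ → X → X) (f : X → ι)
    (F : Finset ℤ) (ε : ℝ) (x : X) : Prop :=
  ∀ i, |μ.real (f ⁻¹' {i}) - nameFreq T f F x i| < ε

/-- `E` is a measurable set of measure more than `1 - ε`, all of whose points have a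
`(T, f, F)`-name with distribution within `ε` of the distribution of `f`. -/
def IsTypicalSet {X ι : Type*} [MeasurableSpace X] (μ : Measure X) (T : ℤ → X → X) (f : X → ι)
    (F : Finset ℤ) (ε : ℝ) (E : Set X) : Prop :=
  MeasurableSet E ∧ μ.real Eᶜ < ε ∧ ∀ x ∈ E, NameWithin μ T f F ε x

/-- `(C_M, B)` is an `ε`-tower of `T`: the levels `T^p B`, `p ∈ C_M`, are pairwise disjoint, and
their union has a complement of measure less than `ε`. -/
def IsTower {X : Type*} [MeasurableSpace X] (μ : Measure X) (T : ℤ → X → X) (M : ℕ) (B : Set X)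
    (ε : ℝ) : Prop :=
  MeasurableSet B ∧
  (Set.Icc (1 : ℤ) M).PairwiseDisjoint (fun p => T p '' B) ∧
  μ.real (⋃ p ∈ Set.Icc (1 : ℤ) M, T p '' B)ᶜ < ε

/-- The atom containing `b` of the pure partition of `B`, in the tower `(C_M, B)` of `T`, relative
to the partition `f`: the points of `B` whose column has the same `f`-name as the column of `b`. -/
def pureAtom {X ι : Type*} (T : ℤ → X → X) (M : ℕ) (B : Set X) (f : X → ι) (b : X) : Set X :=
  {b' ∈ B | ∀ t ∈ Finset.Icc (1 : ℤ) M, f (T t b') = f (T t b)}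

open Classical in
/-- For at least (strictly more than) the fraction `1 - ε` of the `k ∈ C_M`, `T^k b ∈ E`. -/
def MostlyIn {X : Type*} (T : ℤ → X → X) (M : ℕ) (E : Set X) (ε : ℝ) (b : X) : Prop :=
  (1 - ε) * (M : ℝ) < (((Finset.Icc (1 : ℤ) M).filter fun k => T k b ∈ E).card : ℝ)

/-- `π` is a permutation of `C_L` (extended by the identity to `ℤ`) which translates `C_{L - K}`
by `k`.  For `1 ≤ k ≤ K` this is an `(L - K, K, L)`-permutation with translation vector `k`. -/
def TranslatesBy (L K k : ℕ) (π : Equiv.Perm ℤ) : Prop :=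
  (∀ r : ℤ, r ∉ Set.Icc (1 : ℤ) L → π r = r) ∧
  ∀ r ∈ Set.Icc (1 : ℤ) ((L : ℤ) - K), π r = r + k

/-- The permutation of `C_M` (`L ∣ M`) which acts on the `q`-th block `qL + C_L`,
`0 ≤ q < M / L`, by the translate of the permutation `π (τ q)` of `C_L`. -/
def blockPerm (L : ℕ) (π : ℕ → Equiv.Perm ℤ) (τ : ℕ → ℕ) (p : ℤ) : ℤ :=
  (p - 1) / (L : ℤ) * L + π (τ ((p - 1) / (L : ℤ)).toNat) (p - (p - 1) / (L : ℤ) * L)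

open Classical in
/-- Given the tower `(C_M, B)` of `T` and, for each `b ∈ B`, a permutation `σ b` of `C_M`: the
displacement `σ b p - p` of the point `x = T^p b`, `b ∈ B`, `p ∈ C_M`, and `0` if `x` is not in the
tower.  (The levels of a tower are disjoint, so that at most one summand is present.) -/
noncomputable def displacement {X : Type*} (T : ℤ → X → X) (M : ℕ) (B : Set X)
    (σ : X → ℤ → ℤ) (x : X) : ℤ :=
  ∑ p ∈ Finset.Icc (1 : ℤ) M, if T (-p) x ∈ B then σ (T (-p) x) p - p else 0

/-- The map `π_x : ℤ → ℤ` which permutes each stretch of the orbit of `x` lying in one column of the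
tower by the permutation attached to that column, and is the identity off the tower. -/
noncomputable def orbitBijection {X : Type*} (T : ℤ → X → X) (M : ℕ) (B : Set X)
    (σ : X → ℤ → ℤ) (x : X) (v : ℤ) : ℤ :=
  v + displacement T M B σ (T v x)

/-- The cocycle `β(x, g) = π_x(g) - π_x(0)` of `T`. -/
noncomputable def towerCocycle {X : Type*} (T : ℤ → X → X) (M : ℕ) (B : Set X)
    (σ : X → ℤ → ℤ) (x : X) (g : ℤ) : ℤ :=
  orbitBijection T M B σ x g - orbitBijection T M B σ x 0

/-- The action `T^{β⁻¹}` obtained from a cocycle `β` of `T`: `g` acts on `x` as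
`T^{β⁻¹(x, g)}(x)`, where `β(x, β⁻¹(x, g)) = g`. -/
noncomputable def cocycleAction {X : Type*} (T : ℤ → X → X) (β : X → ℤ → ℤ) : ℤ → X → X :=
  fun g x => T (Function.invFun (β x) g) x

/-- The choices made in the course of the construction.  Stages are numbered from `1`; values
at index `0` play no role. -/
structure Choices (X : Type*) where
  /-- the first translation bound `K_1` -/
  K₁ : ℕ
  /-- the block lengths `L_n` -/
  L : ℕ → ℕ
  /-- the tower heights `M_n` -/
  M : ℕ → ℕ
  /-- the tower bases `B_n` -/
  B : ℕ → Set X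
  /-- `perm n k` is the permutation `π_k` of `C_{L_n}` used at stage `n` -/
  perm : ℕ → ℕ → Equiv.Perm ℤ
  /-- `pick n b q` is the `k` with which `π_k` acts on the `q`-th block over `b ∈ B_n` -/
  pick : ℕ → X → ℕ → ℕ
  /-- the distinguished stages `n_1 < n_2 < …` -/
  idx : ℕ → ℕ
  /-- the sets `E_j` of points with typical names -/
  E : ℕ → Set X

variable {X : Type*}

/-- `K_n`, determined by `K_{n + 1} = K_n + 1` for `n ≥ 1`. -/
def Choices.K (D : Choices X) (n : ℕ) : ℕ := D.K₁ + (n - 1)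

/-- The permutation `σ_n(b)` of `C_{M_n}` attached to `b ∈ B_n`. -/
def Choices.σ (D : Choices X) (n : ℕ) (b : X) : ℤ → ℤ :=
  blockPerm (D.L n) (D.perm n) (D.pick n b)

/-- The actions `S_n`: `S_0 = S` and `S_{n + 1} = S_n^{β_{n + 1}⁻¹}`, where `β_{n + 1}` is the
blocked cocycle of `S_n` given by the tower `(C_{M_{n + 1}}, B_{n + 1})` and `σ_{n + 1}`. -/
noncomputable def Choices.action (D : Choices X) (S : Equiv.Perm X) : ℕ → ℤ → X → X
  | 0 => fun g x => (S ^ g) x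
  | n + 1 => cocycleAction (D.action S n)
      (towerCocycle (D.action S n) (D.M (n + 1)) (D.B (n + 1)) (D.σ (n + 1)))

/-- The data of stage `n` define a blocked cocycle `β_n`: the tower is divided into blocks of length
`L_n > K_n`, each `π_k` with `1 ≤ k ≤ K_n` translates `C_{L_n - K_n}` by `k`, and `σ_n` is a measurable
selection on `B_n` from the family of all `K_n ^ (M_n / L_n)` block permutations. -/
structure Choices.IsBlocked [MeasurableSpace X] (D : Choices X) (n : ℕ) : Prop where
  K_lt_L : D.K n < D.L n
  L_dvd_M : D.L n ∣ D.M n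
  perm_translates : ∀ k ∈ Finset.Icc 1 (D.K n), TranslatesBy (D.L n) (D.K n) k (D.perm n k)
  pick_mem : ∀ b ∈ D.B n, ∀ q < D.M n / D.L n, D.pick n b q ∈ Finset.Icc 1 (D.K n)
  pick_measurable : ∀ q < D.M n / D.L n, ∀ k, MeasurableSet {b ∈ D.B n | D.pick n b q = k}

/-- Over each atom `A` of the pure partition of `B_n`, in the tower `(C_{M_n}, B_n)` of `T`,
relative to `f`, the selection `σ_n` is uniformly distributed on the family of all
`K_n ^ (M_n / L_n)` block permutations. -/
def Choices.IsUniform [MeasurableSpace X] (D : Choices X) (μ : Measure X) (T : ℤ → X → X) (n : ℕ)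
    {ι : Type*} (f : X → ι) : Prop :=
  ∀ b ∈ D.B n, ∀ τ : ℕ → ℕ, (∀ q < D.M n / D.L n, τ q ∈ Finset.Icc 1 (D.K n)) →
    μ.real {a ∈ pureAtom T (D.M n) (D.B n) f b | ∀ q < D.M n / D.L n, D.pick n a q = τ q} =
      μ.real (pureAtom T (D.M n) (D.B n) f b) / (D.K n : ℝ) ^ (D.M n / D.L n)

/-- The set `O = {x | S_m(x) = S_n(x)}`. -/
def Choices.agree (D : Choices X) (S : Equiv.Perm X) (m n : ℕ) : Set X :=
  {x | D.action S m 1 x = D.action S n 1 x}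

/-- The choices `D` are made according to the staggered construction from the
transformation `S` of `(X, μ)`, the finite partitions `P n` and the numbers `ε n`, `n ≥ 1`. -/
structure IsConstruction [MeasurableSpace X] (μ : Measure X) (S : Equiv.Perm X) {r : ℕ → ℕ}
    (P : (n : ℕ) → X → Fin (r n)) (ε : ℕ → ℝ) (D : Choices X) : Prop where
  -- The first stage.
  K₁_pos : 0 < D.K₁
  blocked_one : D.IsBlocked 1
  typical_one : IsTypicalSet μ (D.action S 0) (P 1) (Finset.Icc (1 : ℤ) (D.K 1)) (ε 1) (D.E 1)
  L_one : (D.K 1 : ℝ) / ε 1 < D.L 1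
  M_one : (D.L 1 : ℝ) / ε 1 < D.M 1
  tower_one : IsTower μ (D.action S 0) (D.M 1) (D.B 1) (ε 1)
  mostly_one : ∀ b ∈ D.B 1, MostlyIn (D.action S 0) (D.M 1) (D.E 1) (ε 1) b
  uniform_one : D.IsUniform μ (D.action S 0) 1 (P 1)
  -- The distinguished stages: `n_1 = 1`, and `n_{j+1}` is the least number above `n_j` for
  -- which there is a set of points with typical names of length `K_{n_{j+1}}` into the past.
  idx_one : D.idx 1 = 1
  idx_lt : ∀ j ≥ 1, D.idx j < D.idx (j + 1)
  typical : ∀ j ≥ 1, IsTypicalSet μ (D.action S (D.idx j)) (P (j + 1))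
    (Finset.Icc (-(D.K (D.idx (j + 1)) : ℤ)) (-1)) (ε (j + 1)) (D.E (j + 1))
  idx_least : ∀ j ≥ 1, ∀ m, D.idx j < m → m < D.idx (j + 1) →
    ¬ ∃ E : Set X, IsTypicalSet μ (D.action S (D.idx j)) (P (j + 1))
      (Finset.Icc (-(D.K m : ℤ)) (-1)) (ε (j + 1)) E
  -- The stages `n + 1` with `n_j < n + 1 ≤ n_{j+1}`.
  blocked : ∀ n ≥ 1, D.IsBlocked (n + 1)
  L_large : ∀ j ≥ 1, ∀ n, D.idx j ≤ n → n < D.idx (j + 1) →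
    (D.K (D.idx (j + 1)) : ℝ) ^ 3 / D.L (n + 1) < ε (n + 1)
  L_large' : ∀ n : ℕ, 1 ≤ n → ((n : ℝ) + ∑ i ∈ Finset.Icc 1 n, (D.L i : ℝ)) /
    ((D.L (n + 1) : ℝ) - D.K (n + 1)) < ε (n + 1)
  M_large : ∀ n ≥ 1, (D.L (n + 1) : ℝ) / ε (n + 1) < D.M (n + 1)
  M_lt : ∀ n ≥ 1, D.M n < D.M (n + 1)
  tower : ∀ j ≥ 1, ∀ n, D.idx j ≤ n → n < D.idx (j + 1) →
    IsTower μ (D.action S n) (D.M (n + 1)) (D.B (n + 1))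
      (ε (n + 1) / (D.K (D.idx (j + 1)) : ℝ) ^ 2)
  -- Further requirements at the distinguished stages `n + 1 = n_{j+1}`.
  mostly : ∀ j ≥ 1, ∀ n, n + 1 = D.idx (j + 1) → ∀ b ∈ D.B (n + 1),
    MostlyIn (D.action S n) (D.M (n + 1)) (D.E (j + 1)) (ε (j + 1)) b
  agree_within : ∀ j ≥ 1, ∀ n, n + 1 = D.idx (j + 1) → ∀ b ∈ D.B (n + 1),
    NameWithin μ (D.action S n) (fun x => x ∈ D.agree S (D.idx j) n)
      (Finset.Icc (1 : ℤ) (D.M (n + 1))) (ε (n + 1) / D.K (n + 1)) b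
  uniform : ∀ j ≥ 1, ∀ n, n + 1 = D.idx (j + 1) →
    D.IsUniform μ (D.action S n) (n + 1)
      (fun x => (P (j + 1) x, x ∈ D.agree S (D.idx j) n))

/-- The action `T` is `δ`-mixing relative to `(ℓ, P)`: the distributions of `P ∨ T^{-ℓ} P` and
`dist(P) × dist(P)` differ by less than `δ` in every coordinate. -/
def IsMixingRel {ι : Type*} [MeasurableSpace X] (μ : Measure X) (T : ℤ → X → X) (δ : ℝ) (ℓ : ℕ)
    (P : X → ι) : Prop :=
  ∀ p q, |μ.real (P ⁻¹' {p} ∩ T ℓ ⁻¹' (P ⁻¹' {q})) -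
    μ.real (P ⁻¹' {p}) * μ.real (P ⁻¹' {q})| < δ

end Staggered

/-!
At a distinguished stage `n = n_i` the action `T = S_{n-1}` is rearranged inside the columns of a
tower: every block of length `L = L_n` is translated by some `k ∈ {1, …, K}`, `K = K_n`, apart from
its last few positions. Seen from `x` in the bulk of a block with translation number `k`, a step of
length `L` of the new action leads to the same relative position of the next block, whose
translation number is `k'`; hence `S_n^L x = T^{L + k - k'} x` (`IsBlocked.cocycleAction_bulk`).
Since the numbers `k` are uniform and independent given the name of the column
(`IsUniform.measureReal_pick_pair`), the cell of `S_n^L x` is distributed as a sample of the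
`P_i`-name of `T^{L + k} x` over the window `-C_K` (`IsUniform.measureReal_level`).

Such a name is typical for most points. This is required of the action `S_{n_{i-1}}`, and the
intermediate stages change the generator on a set of measure `O(2^{-n_{i-1}} / K^2)`, so that along
a window of length `K` the orbits of `S_{n_{i-1}}` and `T` rarely differ
(`IsConstruction.exists_typical_names`). So the distribution of the cells of `x` and `S_n^L x` is
within `O(2^{-i})` of a product (`IsConstruction.abs_mixing_idx_le`).

Later stages keep this property: a stage `m > n` changes the iterate of order `L_n` only off the
tower and at the last `K_m + L_n` positions of each block of length `L_m`, a set of measure at most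
`3 ε_m`, and `∑ ε_m` over `m > n` is at most `2^{-n}` (`IsConstruction.measureReal_persist_le`).

All identities between actions hold at every point, not merely almost everywhere: the maps `π_x` are
bijections of `ℤ` also for periodic `x`.
-/

namespace Staggered

/-! ### Actions of the integers -/

/-- `T : ℤ → X → X` satisfies the laws of an action of `ℤ`. -/
structure IsAction {X : Type*} (T : ℤ → X → X) : Prop where
  zero : ∀ x, T 0 x = x
  add : ∀ g h x, T (g + h) x = T g (T h x)

namespace IsAction

variable {X : Type*} {T : ℤ → X → X}

theorem apply_neg (hT : IsAction T) (g : ℤ) (x : X) : T g (T (-g) x) = x := by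
  rw [← hT.add, add_neg_cancel, hT.zero]

theorem neg_apply (hT : IsAction T) (g : ℤ) (x : X) : T (-g) (T g x) = x := by
  rw [← hT.add, neg_add_cancel, hT.zero]

theorem injective (hT : IsAction T) (g : ℤ) : Function.Injective (T g) :=
  Function.LeftInverse.injective (hT.neg_apply g)

theorem image_eq_preimage (hT : IsAction T) (g : ℤ) (A : Set X) : T g '' A = T (-g) ⁻¹' A :=
  congrFun (Set.image_eq_preimage_of_inverse (hT.neg_apply g) (hT.apply_neg g)) A

end IsAction

/-! ### Rearranging the columns of a tower -/

/-- The levels `T^p B`, `p ∈ C_M`, of the action `T` are pairwise disjoint, and `σ b` is a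
permutation of `C_M` for each `b ∈ B`. -/
structure IsColumnScheme {X : Type*} (T : ℤ → X → X) (M : ℕ) (B : Set X) (σ : X → ℤ → ℤ) :
    Prop where
  action : IsAction T
  disjoint : (Set.Icc (1 : ℤ) M).PairwiseDisjoint (fun p => T p '' B)
  bijOn : ∀ b ∈ B, Set.BijOn (σ b) (Set.Icc (1 : ℤ) M) (Set.Icc (1 : ℤ) M)

namespace IsColumnScheme

variable {X : Type*} {T : ℤ → X → X} {M : ℕ} {B : Set X} {σ : X → ℤ → ℤ}

theorem level_unique (h : IsColumnScheme T M B σ) {p p' : ℤ} (hp : p ∈ Set.Icc (1 : ℤ) M)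
    (hp' : p' ∈ Set.Icc (1 : ℤ) M) {x : X} (hx : T (-p) x ∈ B) (hx' : T (-p') x ∈ B) : p = p' := by
  by_contra hne
  have hd := h.disjoint hp hp' hne
  simp only [Function.onFun, h.action.image_eq_preimage] at hd
  exact Set.disjoint_left.mp hd hx hx'

theorem displacement_of_mem (h : IsColumnScheme T M B σ) {p : ℤ} (hp : p ∈ Set.Icc (1 : ℤ) M)
    {b : X} (hb : b ∈ B) : displacement T M B σ (T p b) = σ b p - p := by
  unfold displacement
  rw [Finset.sum_eq_single p]
  · simp [h.action.neg_apply, hb]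
  · intro p' hp' hne
    rw [if_neg]
    intro hmem
    exact hne (h.level_unique (Finset.mem_Icc.mp hp') hp hmem
      (by rwa [h.action.neg_apply]))
  · intro hn
    exact absurd (Finset.mem_Icc.mpr hp) hn

theorem orbitBijection_of_mem (h : IsColumnScheme T M B σ) {x : X} {u p : ℤ}
    (hp : p ∈ Set.Icc (1 : ℤ) M) (hu : T u x ∈ B) :
    orbitBijection T M B σ x (u + p) = u + σ (T u x) p := by
  unfold orbitBijection
  rw [add_comm u p, h.action.add, h.displacement_of_mem hp hu]
  ring

theorem orbitBijection_of_not_mem (h : IsColumnScheme T M B σ) {x : X} {v : ℤ}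
    (hv : ∀ p ∈ Set.Icc (1 : ℤ) M, T (v - p) x ∉ B) : orbitBijection T M B σ x v = v := by
  unfold orbitBijection displacement
  rw [Finset.sum_eq_zero, add_zero]
  intro p hp
  rw [← h.action.add, if_neg]
  rw [neg_add_eq_sub]
  exact hv p (Finset.mem_Icc.mp hp)

theorem orbitBijection_bijective (h : IsColumnScheme T M B σ) (x : X) :
    Function.Bijective (orbitBijection T M B σ x) := by
  -- every integer lies in a stretch `u + C_M` over the base, or off the tower
  have key : ∀ v, (∃ u p, p ∈ Set.Icc (1 : ℤ) M ∧ T u x ∈ B ∧ v = u + p) ∨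
      ∀ p ∈ Set.Icc (1 : ℤ) M, T (v - p) x ∉ B := by
    intro v
    by_contra! hc
    obtain ⟨p, hp, hm⟩ := hc.2
    exact hc.1 (v - p) p hp hm (by ring)
  constructor
  · intro v v' hvv
    rcases key v with ⟨u, p, hp, hu, rfl⟩ | hv <;> rcases key v' with ⟨u', p', hp', hu', rfl⟩ | hv'
    · rw [h.orbitBijection_of_mem hp hu, h.orbitBijection_of_mem hp' hu'] at hvv
      have hs := (h.bijOn _ hu).mapsTo hp
      have hs' := (h.bijOn _ hu').mapsTo hp'
      have e : σ (T u x) p = σ (T u' x) p' := by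
        refine h.level_unique hs hs' (x := T (u + σ (T u x) p) x) ?_ ?_
        · rw [← h.action.add]; simpa using hu
        · rw [hvv, ← h.action.add]; simpa using hu'
      obtain rfl : u = u' := by linarith
      rw [(h.bijOn _ hu).injOn hp hp' e]
    · rw [h.orbitBijection_of_mem hp hu, h.orbitBijection_of_not_mem hv'] at hvv
      refine absurd ?_ (hv' _ ((h.bijOn _ hu).mapsTo hp))
      rw [← hvv]; simpa using hu
    · rw [h.orbitBijection_of_mem hp' hu', h.orbitBijection_of_not_mem hv] at hvv
      refine absurd ?_ (hv _ ((h.bijOn _ hu').mapsTo hp'))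
      rw [hvv]; simpa using hu'
    · rwa [h.orbitBijection_of_not_mem hv, h.orbitBijection_of_not_mem hv'] at hvv
  · intro w
    rcases key w with ⟨u, p, hp, hu, rfl⟩ | hw
    · obtain ⟨p', hp', e⟩ := (h.bijOn _ hu).surjOn hp
      exact ⟨u + p', by rw [h.orbitBijection_of_mem hp' hu, e]⟩
    · exact ⟨w, h.orbitBijection_of_not_mem hw⟩

theorem towerCocycle_bijective (h : IsColumnScheme T M B σ) (x : X) :
    Function.Bijective (towerCocycle T M B σ x) :=
  (Equiv.subRight (orbitBijection T M B σ x 0)).bijective.comp (h.orbitBijection_bijective x)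

theorem towerCocycle_add (h : IsColumnScheme T M B σ) (x : X) (g k : ℤ) :
    towerCocycle T M B σ x (g + k) =
      towerCocycle T M B σ (T k x) g + towerCocycle T M B σ x k := by
  unfold towerCocycle orbitBijection
  rw [h.action.add, h.action.zero, h.action.zero]
  ring

theorem cocycleAction_towerCocycle (h : IsColumnScheme T M B σ) (x : X) (k : ℤ) :
    cocycleAction T (towerCocycle T M B σ) (towerCocycle T M B σ x k) x = T k x := by
  unfold cocycleAction
  rw [Function.leftInverse_invFun (h.towerCocycle_bijective x).injective k]

theorem isAction_cocycleAction (h : IsColumnScheme T M B σ) :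
    IsAction (cocycleAction T (towerCocycle T M B σ)) := by
  constructor
  · intro x
    have := h.cocycleAction_towerCocycle x 0
    rwa [h.action.zero, show towerCocycle T M B σ x 0 = 0 from sub_self _] at this
  · intro g g' x
    obtain ⟨k', rfl⟩ := (h.towerCocycle_bijective x).surjective g'
    rw [h.cocycleAction_towerCocycle]
    obtain ⟨k, rfl⟩ := (h.towerCocycle_bijective (T k' x)).surjective g
    rw [h.cocycleAction_towerCocycle, ← h.towerCocycle_add, h.cocycleAction_towerCocycle,
      h.action.add]

/-- The rearranged action meets the points of a column in the order given by `σ b`: the point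
`T^s b` now stands at height `σ b s`. -/
theorem cocycleAction_column (h : IsColumnScheme T M B σ) {b : X} (hb : b ∈ B) {s t : ℤ}
    (hs : s ∈ Set.Icc (1 : ℤ) M) (ht : t ∈ Set.Icc (1 : ℤ) M) :
    cocycleAction T (towerCocycle T M B σ) (σ b t - σ b s) (T s b) = T t b := by
  have e : towerCocycle T M B σ (T s b) (t - s) = σ b t - σ b s := by
    unfold towerCocycle orbitBijection
    rw [h.action.zero, ← h.action.add, sub_add_cancel, h.displacement_of_mem hs hb,
      h.displacement_of_mem ht hb]
    ring
  rw [← e, h.cocycleAction_towerCocycle, ← h.action.add, sub_add_cancel]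

theorem measurePreserving_cocycleAction [MeasurableSpace X] {μ : Measure X}
    (h : IsColumnScheme T M B σ) (hT : ∀ g, MeasurePreserving (T g) μ μ)
    (hd : Measurable (displacement T M B σ)) (g : ℤ) :
    MeasurePreserving (cocycleAction T (towerCocycle T M B σ) g) μ μ := by
  set T' := cocycleAction T (towerCocycle T M B σ) with hT'
  have hact := h.isAction_cocycleAction
  rw [← hT'] at hact
  -- `X` is cut into the countably many sets `C k` on which `T' g` coincides with `T k`
  let C : ℤ → Set X := fun k => {x | towerCocycle T M B σ x k = g}
  have hCeq : ∀ k, ∀ x ∈ C k, T' g x = T k x := by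
    intro k x hx
    have := h.cocycleAction_towerCocycle x k
    rwa [show towerCocycle T M B σ x k = g from hx] at this
  have hCm : ∀ k, MeasurableSet (C k) := by
    intro k
    have hm : ∀ v, Measurable fun x => orbitBijection T M B σ x v := fun v =>
      measurable_const.add (hd.comp (hT v).measurable)
    exact ((hm k).sub (hm 0)) (measurableSet_singleton g)
  have hCd : Pairwise (Function.onFun Disjoint C) := by
    intro k k' hne
    refine Set.disjoint_left.mpr fun x hx hx' => hne ?_
    exact (h.towerCocycle_bijective x).injective (hx.trans (Eq.symm hx'))
  have hCu : ⋃ k, C k = Set.univ := by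
    refine Set.eq_univ_of_forall fun x => ?_
    obtain ⟨k, hk⟩ := (h.towerCocycle_bijective x).surjective g
    exact Set.mem_iUnion.mpr ⟨k, hk⟩
  have hpre : ∀ A : Set X, T' g ⁻¹' A = ⋃ k, T k ⁻¹' A ∩ C k := by
    intro A
    rw [← Set.inter_univ (T' g ⁻¹' A), ← hCu, Set.inter_iUnion]
    refine Set.iUnion_congr fun k => Set.ext fun x => ?_
    refine and_congr_left fun hx => ?_
    rw [Set.mem_preimage, Set.mem_preimage, hCeq k x hx]
  have hmeas : Measurable (T' g) := by
    intro A hA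
    rw [hpre]
    exact MeasurableSet.iUnion fun k => ((hT k).measurable hA).inter (hCm k)
  refine ⟨hmeas, Measure.ext fun A hA => ?_⟩
  rw [Measure.map_apply hmeas hA, hpre, measure_iUnion
    (fun k k' hne => (hCd hne).mono Set.inter_subset_right Set.inter_subset_right)
    (fun k => ((hT k).measurable hA).inter (hCm k))]
  -- the images `T k '' C k = T' g '' C k` again partition `X`, by bijectivity of `T' g`
  let I : ℤ → Set X := fun k => T (-k) ⁻¹' C k
  have hI : ∀ k, I k = T' g '' C k := by
    intro k
    rw [Set.image_congr (hCeq k), h.action.image_eq_preimage]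
  have hA' : A = ⋃ k, A ∩ I k := by
    rw [← Set.inter_iUnion, show (⋃ k, I k) = Set.univ from ?_, Set.inter_univ]
    simp_rw [hI]
    rw [← Set.image_iUnion, hCu, Set.image_univ]
    exact Set.range_eq_univ.mpr fun y => ⟨T' (-g) y, hact.apply_neg g y⟩
  have hIm : ∀ k, MeasurableSet (I k) := fun k => (hT (-k)).measurable (hCm k)
  conv_rhs => rw [hA']
  rw [measure_iUnion _ (fun k => hA.inter (hIm k))]
  · refine tsum_congr fun k => ?_
    rw [← (hT k).measure_preimage (hA.inter (hIm k)).nullMeasurableSet, Set.preimage_inter]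
    congr 2
    ext x
    simp [I, h.action.neg_apply]
  · intro k k' hne
    refine Disjoint.mono Set.inter_subset_right Set.inter_subset_right ?_
    rw [hI, hI]
    exact (Set.disjoint_image_iff (hact.injective g)).mpr (hCd hne)

end IsColumnScheme

/-! ### Block permutations -/

section Blocks

variable {L M : ℕ}

theorem block_ediv_emod (hL : 0 < L) (u : ℕ) {r : ℤ} (hr : r ∈ Set.Icc (1 : ℤ) L) :
    ((u : ℤ) * L + r - 1) / (L : ℤ) = u ∧ ((u : ℤ) * L + r - 1) % (L : ℤ) = r - 1 := by
  obtain ⟨h1, h2⟩ := hr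
  have hL' : (0 : ℤ) < L := by exact_mod_cast hL
  rw [Int.ediv_emod_unique hL']
  refine ⟨by ring, by linarith, by linarith⟩

theorem exists_block (hL : 0 < L) (hLM : L ∣ M) {p : ℤ} (hp : p ∈ Set.Icc (1 : ℤ) M) :
    ∃ u : ℕ, u < M / L ∧ ∃ r ∈ Set.Icc (1 : ℤ) L, p = u * L + r := by
  obtain ⟨Q, rfl⟩ := hLM
  obtain ⟨h1, h2⟩ := hp
  have hL' : (0 : ℤ) < L := by exact_mod_cast hL
  have e := Int.mul_ediv_add_emod (p - 1) L
  have h0 := Int.emod_nonneg (p - 1) hL'.ne'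
  have h3 := Int.emod_lt_of_pos (p - 1) hL'
  have h4 : 0 ≤ (p - 1) / (L : ℤ) := Int.ediv_nonneg (by linarith) hL'.le
  have h5 : (p - 1) / (L : ℤ) < Q := by
    apply Int.ediv_lt_of_lt_mul hL'
    push_cast at h2
    linarith [mul_comm (L : ℤ) Q]
  rw [Nat.mul_div_cancel_left _ hL]
  refine ⟨((p - 1) / (L : ℤ)).toNat, by omega, (p - 1) % (L : ℤ) + 1, ⟨by linarith, by linarith⟩, ?_⟩
  rw [Int.toNat_of_nonneg h4]
  linarith

theorem block_mem_Icc (hLM : L ∣ M) {u : ℕ} (hu : u < M / L) {r : ℤ}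
    (hr : r ∈ Set.Icc (1 : ℤ) L) : (u : ℤ) * L + r ∈ Set.Icc (1 : ℤ) M := by
  obtain ⟨Q, rfl⟩ := hLM
  obtain ⟨h1, h2⟩ := hr
  have hL : 0 < L := by have : (0 : ℤ) < L := by linarith
                        exact_mod_cast this
  rw [Nat.mul_div_cancel_left _ hL] at hu
  have hu' : (u : ℤ) + 1 ≤ Q := by exact_mod_cast hu
  constructor
  · have : (0 : ℤ) ≤ u * L := by positivity
    linarith
  · push_cast
    nlinarith [mul_le_mul_of_nonneg_right hu' (by positivity : (0 : ℤ) ≤ L)]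

theorem blockPerm_apply (hL : 0 < L) (π : ℕ → Equiv.Perm ℤ) (τ : ℕ → ℕ) (u : ℕ) {r : ℤ}
    (hr : r ∈ Set.Icc (1 : ℤ) L) : blockPerm L π τ (u * L + r) = u * L + π (τ u) r := by
  unfold blockPerm
  rw [(block_ediv_emod hL u hr).1, Int.toNat_natCast, add_sub_cancel_left]

theorem TranslatesBy.bijOn {K k : ℕ} {π : Equiv.Perm ℤ} (h : TranslatesBy L K k π) :
    Set.BijOn π (Set.Icc (1 : ℤ) L) (Set.Icc (1 : ℤ) L) := by
  refine ⟨fun r hr => ?_, π.injective.injOn, fun r hr => ⟨π.symm r, ?_, π.apply_symm_apply r⟩⟩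
  · by_contra hn
    exact hn (by rwa [π.injective (h.1 _ hn)])
  · by_contra hn
    have := h.1 _ hn
    rw [π.apply_symm_apply] at this
    exact hn (this ▸ hr)

theorem blockPerm_bijOn (hL : 0 < L) (hLM : L ∣ M) {π : ℕ → Equiv.Perm ℤ} {τ : ℕ → ℕ}
    (h : ∀ u < M / L, Set.BijOn (π (τ u)) (Set.Icc (1 : ℤ) L) (Set.Icc (1 : ℤ) L)) :
    Set.BijOn (blockPerm L π τ) (Set.Icc (1 : ℤ) M) (Set.Icc (1 : ℤ) M) := by
  refine ⟨fun p hp => ?_, fun p hp p' hp' e => ?_, fun p hp => ?_⟩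
  · obtain ⟨u, hu, r, hr, rfl⟩ := exists_block hL hLM hp
    rw [blockPerm_apply hL _ _ _ hr]
    exact block_mem_Icc hLM hu ((h u hu).mapsTo hr)
  · obtain ⟨u, hu, r, hr, rfl⟩ := exists_block hL hLM hp
    obtain ⟨u', hu', r', hr', rfl⟩ := exists_block hL hLM hp'
    rw [blockPerm_apply hL _ _ _ hr, blockPerm_apply hL _ _ _ hr'] at e
    have h1 := (block_ediv_emod hL u ((h u hu).mapsTo hr)).1
    have h2 := (block_ediv_emod hL u' ((h u' hu').mapsTo hr')).1
    rw [e, h2] at h1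
    obtain rfl : u' = u := by exact_mod_cast h1
    rw [(h u' hu).injOn hr hr' (add_left_cancel e)]
  · obtain ⟨u, hu, r, hr, rfl⟩ := exists_block hL hLM hp
    obtain ⟨r', hr', rfl⟩ := (h u hu).surjOn hr
    exact ⟨u * L + r', block_mem_Icc hLM hu hr', blockPerm_apply hL _ _ _ hr'⟩

/-- At most `#R` positions of each block of length `L` in `C_M` have their residue, counted from
`1` to `L`, in `R`. -/
theorem card_filter_residue_le (hL : 0 < L) (hLM : L ∣ M) (R : Finset ℤ) :
    ((Finset.Icc (1 : ℤ) M).filter fun p => (p - 1) % (L : ℤ) + 1 ∈ R).card ≤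
      M / L * R.card := by
  have hL' : (0 : ℤ) < L := by exact_mod_cast hL
  rw [← Finset.card_range (M / L), ← Finset.card_product]
  refine Finset.card_le_card_of_injOn (fun p => (((p - 1) / (L : ℤ)).toNat, (p - 1) % (L : ℤ) + 1))
    ?_ ?_
  · intro p hp
    rw [Finset.mem_coe, Finset.mem_filter, Finset.mem_Icc] at hp
    obtain ⟨u, hu, r, hr, rfl⟩ := exists_block hL hLM hp.1
    rw [Finset.mem_coe, Finset.mem_product]
    refine ⟨?_, hp.2⟩
    rw [Finset.mem_range]
    dsimp only
    rwa [(block_ediv_emod hL u hr).1, Int.toNat_natCast]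
  · intro p hp p' hp' e
    rw [Finset.mem_coe, Finset.mem_filter, Finset.mem_Icc] at hp hp'
    obtain ⟨u, hu, r, hr, rfl⟩ := exists_block hL hLM hp.1
    obtain ⟨u', hu', r', hr', rfl⟩ := exists_block hL hLM hp'.1
    rw [Prod.mk.injEq] at e
    rw [(block_ediv_emod hL u hr).1, (block_ediv_emod hL u hr).2, (block_ediv_emod hL u' hr').1,
      (block_ediv_emod hL u' hr').2, Int.toNat_natCast, Int.toNat_natCast] at e
    rw [e.1]
    linarith [e.2]

end Blocks

/-! ### Blocked stages -/

namespace Choices.IsBlocked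

variable {X : Type*} [MeasurableSpace X] {D : Choices X} {n : ℕ}

theorem L_pos (h : D.IsBlocked n) : 0 < D.L n := (Nat.zero_le _).trans_lt h.K_lt_L

theorem bijOn (h : D.IsBlocked n) {b : X} (hb : b ∈ D.B n) :
    Set.BijOn (D.σ n b) (Set.Icc (1 : ℤ) (D.M n)) (Set.Icc (1 : ℤ) (D.M n)) :=
  blockPerm_bijOn h.L_pos h.L_dvd_M fun u hu => (h.perm_translates _ (h.pick_mem b hb u hu)).bijOn

theorem isColumnScheme (h : D.IsBlocked n) {μ : Measure X} {T : ℤ → X → X} {e : ℝ}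
    (hT : IsAction T) (ht : IsTower μ T (D.M n) (D.B n) e) :
    IsColumnScheme T (D.M n) (D.B n) (D.σ n) :=
  ⟨hT, ht.2.1, fun _ hb => h.bijOn hb⟩

theorem σ_apply (h : D.IsBlocked n) {b : X} (hb : b ∈ D.B n) {u : ℕ} (hu : u < D.M n / D.L n)
    {r : ℤ} (hr : r ∈ Set.Icc (1 : ℤ) ((D.L n : ℤ) - D.K n)) :
    D.σ n b (u * D.L n + r) = u * D.L n + r + D.pick n b u := by
  unfold Choices.σ
  rw [blockPerm_apply h.L_pos _ _ _ ⟨hr.1, by linarith [hr.2, Int.natCast_nonneg (D.K n)]⟩,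
    (h.perm_translates _ (h.pick_mem b hb u hu)).2 r hr]
  ring

theorem measurable_displacement (h : D.IsBlocked n) {μ : Measure X} {T : ℤ → X → X}
    (hT : ∀ g, MeasurePreserving (T g) μ μ) (hB : MeasurableSet (D.B n)) :
    Measurable (displacement T (D.M n) (D.B n) (D.σ n)) := by
  classical
  unfold displacement
  refine Finset.measurable_sum _ fun p hp => ?_
  obtain ⟨u, hu, r, hr, rfl⟩ := exists_block h.L_pos h.L_dvd_M (Finset.mem_Icc.mp hp)
  -- the summand is a function of the label `pick n b u`, set to `none` off `B_n`
  let G : X → ℤ := fun b => if b ∈ D.B n then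
    D.σ n b (u * D.L n + r) - (u * D.L n + r) else 0
  suffices hG : Measurable G from hG.comp (hT _).measurable
  let N : X → Option ℕ := fun b => if b ∈ D.B n then some (D.pick n b u) else none
  have hN : @Measurable _ _ _ ⊤ N := by
    let _ : MeasurableSpace (Option ℕ) := ⊤
    refine measurable_to_countable' fun o => ?_
    cases o with
    | none =>
      convert hB.compl using 1
      ext b
      by_cases hb : b ∈ D.B n <;> simp [N, hb]
    | some k =>
      convert h.pick_measurable u hu k using 1
      ext b
      by_cases hb : b ∈ D.B n <;> simp [N, hb]
  have e : G = (fun o : Option ℕ =>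
      o.elim 0 fun k => (u * D.L n + D.perm n k r) - ((u : ℤ) * D.L n + r)) ∘ N := by
    funext b
    by_cases hb : b ∈ D.B n
    · simp only [G, N, hb, if_true, Function.comp, Option.elim_some]
      unfold Choices.σ
      rw [blockPerm_apply h.L_pos _ _ _ hr]
    · simp [G, N, hb]
  rw [e]
  exact @Measurable.comp _ _ _ _ ⊤ _ _ _ measurable_from_top hN

end Choices.IsBlocked

/-! ### Measure of levels of a tower -/

section Levels

variable {X : Type*} [MeasurableSpace X] {μ : Measure X} {T : ℤ → X → X} {M : ℕ}
  {B : Set X} {e : ℝ}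

theorem IsAction.measurableSet_image (hT : IsAction T) (hmp : ∀ g, MeasurePreserving (T g) μ μ)
    (g : ℤ) {A : Set X} (hA : MeasurableSet A) : MeasurableSet (T g '' A) := by
  rw [hT.image_eq_preimage]
  exact (hmp _).measurable hA

theorem IsAction.measureReal_image (hT : IsAction T) (hmp : ∀ g, MeasurePreserving (T g) μ μ)
    (g : ℤ) {A : Set X} (hA : MeasurableSet A) : μ.real (T g '' A) = μ.real A := by
  rw [hT.image_eq_preimage, (hmp _).measureReal_preimage hA.nullMeasurableSet]

/-- The base of a tower of height `M` has measure at most `1 / M`, so that discarding `N` levels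
costs at most `N / M`. -/
theorem IsTower.measureReal_levels_compl_le [IsProbabilityMeasure μ] (hT : IsAction T)
    (hmp : ∀ g, MeasurePreserving (T g) μ μ) (ht : IsTower μ T M B e) (hM : 0 < M)
    {I : Finset ℤ} {N : ℕ} (hN : (Finset.Icc (1 : ℤ) M \ I).card ≤ N) :
    μ.real (⋃ p ∈ I, T p '' B)ᶜ ≤ e + N / M := by
  obtain ⟨hB, hd, hc⟩ := ht
  have hM' : (0 : ℝ) < M := by exact_mod_cast hM
  have hbase : μ.real B ≤ 1 / M := by
    rw [le_div_iff₀ hM']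
    have h1 : μ.real (⋃ p ∈ Finset.Icc (1 : ℤ) M, T p '' B) = M * μ.real B := by
      rw [measureReal_biUnion_finset (by rwa [Finset.coe_Icc])
        (fun p _ => hT.measurableSet_image hmp p hB)]
      simp [hT.measureReal_image hmp _ hB]
    rw [mul_comm, ← h1]
    exact measureReal_le_one
  have hsub : (⋃ p ∈ I, T p '' B)ᶜ ⊆
      (⋃ p ∈ Set.Icc (1 : ℤ) M, T p '' B)ᶜ ∪ ⋃ p ∈ Finset.Icc (1 : ℤ) M \ I, T p '' B := by
    intro x hx
    by_contra hn
    rw [Set.mem_union, not_or, Set.notMem_compl_iff] at hn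
    obtain ⟨p, hp, hxp⟩ := Set.mem_iUnion₂.mp hn.1
    refine hx (Set.mem_iUnion₂.mpr ⟨p, ?_, hxp⟩)
    by_contra hpI
    exact hn.2 (Set.mem_iUnion₂.mpr
      ⟨p, Finset.mem_sdiff.mpr ⟨Finset.mem_Icc.mpr hp, hpI⟩, hxp⟩)
  calc μ.real (⋃ p ∈ I, T p '' B)ᶜ
      ≤ _ := measureReal_mono hsub
    _ ≤ _ := measureReal_union_le _ _
    _ ≤ e + ∑ p ∈ Finset.Icc (1 : ℤ) M \ I, μ.real (T p '' B) :=
        add_le_add hc.le (measureReal_biUnion_finset_le _ _)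
    _ ≤ e + N * (1 / M) := by
        simp only [hT.measureReal_image hmp _ hB, Finset.sum_const, nsmul_eq_mul]
        gcongr
    _ = e + N / M := by ring

end Levels

/-! ### The effect of a rearrangement on iterates -/

section Persistence

variable {X : Type*} [MeasurableSpace X] {μ : Measure X} {D : Choices X} {n : ℕ}
  {T : ℤ → X → X} {e : ℝ}

/-- A blocked rearrangement changes the iterate `T^ℓ` only off the tower and at the last `K + ℓ`
positions of each block, because a block is translated rigidly up to its last `K` positions. -/
theorem Choices.IsBlocked.measureReal_ne_le [IsProbabilityMeasure μ] (h : D.IsBlocked n)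
    (hT : IsAction T) (hmp : ∀ g, MeasurePreserving (T g) μ μ)
    (ht : IsTower μ T (D.M n) (D.B n) e) (hM : 0 < D.M n) (ℓ : ℕ) :
    μ.real {x | cocycleAction T (towerCocycle T (D.M n) (D.B n) (D.σ n)) ℓ x ≠ T ℓ x} ≤
      e + ((D.K n : ℝ) + ℓ) / D.L n := by
  set L := D.L n
  set M := D.M n
  have hL := h.L_pos
  let R : Finset ℤ := Finset.Ioc ((L : ℤ) - D.K n - ℓ) L
  let I : Finset ℤ := (Finset.Icc (1 : ℤ) M).filter fun p => (p - 1) % (L : ℤ) + 1 ∉ R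
  have hcard : (Finset.Icc (1 : ℤ) M \ I).card ≤ M / L * (D.K n + ℓ) := by
    have e1 : Finset.Icc (1 : ℤ) M \ I =
        (Finset.Icc (1 : ℤ) M).filter fun p => (p - 1) % (L : ℤ) + 1 ∈ R := by
      rw [← Finset.filter_not]
      exact Finset.filter_congr fun _ _ => not_not
    have e2 : R.card = D.K n + ℓ := by
      rw [Int.card_Ioc]; omega
    rw [e1, ← e2]
    exact card_filter_residue_le hL h.L_dvd_M R
  have hsub : {x | cocycleAction T (towerCocycle T M (D.B n) (D.σ n)) ℓ x ≠ T ℓ x} ⊆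
      (⋃ p ∈ I, T p '' D.B n)ᶜ := by
    intro x hx hmem
    obtain ⟨p, hp, b, hb, rfl⟩ := Set.mem_iUnion₂.mp hmem
    rw [Finset.mem_filter, Finset.mem_Icc] at hp
    obtain ⟨u, hu, r, hr, rfl⟩ := exists_block hL h.L_dvd_M hp.1
    have hp2 := hp.2
    rw [(block_ediv_emod hL u hr).2, Finset.mem_Ioc] at hp2
    have hr1 := hr.1
    have hr2 := hr.2
    have hr' : r + ℓ ≤ (L : ℤ) - D.K n := by
      by_contra hcon
      exact hp2 ⟨by linarith, by linarith⟩
    have hℓ : (0 : ℤ) ≤ ℓ := Int.natCast_nonneg _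
    have hK : (0 : ℤ) ≤ D.K n := Int.natCast_nonneg _
    have hcol := (h.isColumnScheme hT ht).cocycleAction_column hb
      (block_mem_Icc h.L_dvd_M hu hr)
      (block_mem_Icc h.L_dvd_M hu (r := r + ℓ) ⟨by linarith, by linarith⟩)
    rw [h.σ_apply hb hu ⟨hr1, by linarith⟩, h.σ_apply hb hu ⟨by linarith, hr'⟩,
      show (u : ℤ) * L + (r + ℓ) + D.pick n b u - (u * L + r + D.pick n b u) = ℓ by ring] at hcol
    refine hx ?_
    rw [hcol, ← hT.add]
    congr 1
    ring
  refine (measureReal_mono hsub).trans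
    ((ht.measureReal_levels_compl_le hT hmp hM hcard).trans_eq ?_)
  congr 1
  obtain ⟨Q, hQ⟩ := h.L_dvd_M
  change M = L * Q at hQ
  rw [hQ, Nat.mul_div_cancel_left _ hL]
  have hQ0 : (Q : ℝ) ≠ 0 := by
    rintro h0
    rw [Nat.cast_eq_zero] at h0
    simp [hQ, h0] at hM
  have hL0 : (L : ℝ) ≠ 0 := by exact_mod_cast hL.ne'
  push_cast
  field_simp

end Persistence

/-! ### The actions of the construction -/

theorem isAction_zpow {X : Type*} (S : Equiv.Perm X) : IsAction fun g x => (S ^ g) x :=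
  ⟨fun x => by simp, fun g h x => by simp [zpow_add]⟩

theorem measurePreserving_zpow {X : Type*} [MeasurableSpace X] {μ : Measure X} (S : X ≃ᵐ X)
    (hS : MeasurePreserving S μ μ) (g : ℤ) :
    MeasurePreserving (fun x => ((S.toEquiv : Equiv.Perm X) ^ g) x) μ μ := by
  have key : ∀ (R : X ≃ᵐ X), MeasurePreserving R μ μ → ∀ n : ℕ,
      MeasurePreserving (fun x => ((R.toEquiv : Equiv.Perm X) ^ n) x) μ μ := by
    intro R hR n
    have := hR.iterate n
    rwa [show (R : X → X)^[n] = fun x => ((R.toEquiv : Equiv.Perm X) ^ n) x from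
      Equiv.Perm.iterate_eq_pow R.toEquiv n] at this
  cases g with
  | ofNat n => simpa using key S hS n
  | negSucc n =>
    have h := key S.symm (hS.symm S) (n + 1)
    have e : (S.symm.toEquiv : Equiv.Perm X) = (S.toEquiv : Equiv.Perm X)⁻¹ := rfl
    rw [e, inv_pow] at h
    simpa only [zpow_negSucc] using h

theorem Choices.K_mono {X : Type*} (D : Choices X) {m n : ℕ} (h : m ≤ n) :
    D.K m ≤ D.K n := by
  unfold Choices.K
  omega

theorem Choices.measureReal_action_ne_le {X : Type*} [MeasurableSpace X] {μ : Measure X}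
    [IsFiniteMeasure μ] (D : Choices X) (S : Equiv.Perm X) (ℓ : ℤ) {m n : ℕ} (hmn : m ≤ n) :
    μ.real {x | D.action S m ℓ x ≠ D.action S n ℓ x} ≤
      ∑ t ∈ Finset.Ico m n,
        μ.real {x | D.action S (t + 1) ℓ x ≠ D.action S t ℓ x} := by
  induction n, hmn using Nat.le_induction with
  | base => simp
  | succ n hn ih =>
    rw [Finset.sum_Ico_succ_top hn]
    refine (measureReal_mono (fun x hx => ?_)).trans
      ((measureReal_union_le _ _).trans (add_le_add_left ih _))
    by_contra hc
    rw [Set.mem_union, not_or] at hc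
    have h1 := not_not.mp hc.1
    have h2 := not_not.mp hc.2
    exact hx (h1.trans h2.symm)

namespace IsConstruction

variable {X : Type*} [MeasurableSpace X] {μ : Measure X} {S : X ≃ᵐ X}
  {r : ℕ → ℕ} {P : (n : ℕ) → X → Fin (r n)} {ε : ℕ → ℝ} {D : Choices X}

theorem le_idx (hD : IsConstruction μ S.toEquiv P ε D) {j : ℕ} (hj : 1 ≤ j) : j ≤ D.idx j := by
  induction j, hj using Nat.le_induction with
  | base => exact hD.idx_one.ge
  | succ j hj ih => exact ih.trans_lt (hD.idx_lt j hj)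

theorem idx_mono (hD : IsConstruction μ S.toEquiv P ε D) {i j : ℕ} (hi : 1 ≤ i) (hij : i ≤ j) :
    D.idx i ≤ D.idx j := by
  induction j, hij using Nat.le_induction with
  | base => exact le_rfl
  | succ j hj ih => exact ih.trans (hD.idx_lt j (hi.trans hj)).le

theorem exists_idx (hD : IsConstruction μ S.toEquiv P ε D) {n : ℕ} (hn : 1 ≤ n) :
    ∃ j ≥ 1, D.idx j ≤ n ∧ n < D.idx (j + 1) := by
  induction n, hn using Nat.le_induction with
  | base => exact ⟨1, le_rfl, hD.idx_one.le, hD.idx_one.symm.trans_lt (hD.idx_lt 1 le_rfl)⟩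
  | succ n hn ih =>
    obtain ⟨j, hj, h1, h2⟩ := ih
    rcases lt_or_ge (n + 1) (D.idx (j + 1)) with h | h
    · exact ⟨j, hj, by omega, h⟩
    · exact ⟨j + 1, by omega, h, by have := hD.idx_lt (j + 1) (by omega); omega⟩

theorem K_pos (hD : IsConstruction μ S.toEquiv P ε D) (n : ℕ) : 0 < D.K n :=
  Nat.add_pos_left hD.K₁_pos _

theorem blocked_succ (hD : IsConstruction μ S.toEquiv P ε D) (n : ℕ) : D.IsBlocked (n + 1) := by
  rcases Nat.eq_zero_or_pos n with rfl | hn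
  · exact hD.blocked_one
  · exact hD.blocked n hn

theorem exists_tower_succ (hD : IsConstruction μ S.toEquiv P ε D) (n : ℕ) :
    ∃ e, IsTower μ (D.action S.toEquiv n) (D.M (n + 1)) (D.B (n + 1)) e := by
  rcases Nat.eq_zero_or_pos n with rfl | hn
  · exact ⟨_, hD.tower_one⟩
  · obtain ⟨j, hj, h1, h2⟩ := hD.exists_idx hn
    exact ⟨_, hD.tower j hj n h1 h2⟩

theorem M_pos (hD : IsConstruction μ S.toEquiv P ε D) (hε_pos : ∀ n ≥ 1, 0 < ε n) {n : ℕ}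
    (hn : 1 ≤ n) : 0 < D.M (n + 1) := by
  have h1 := hD.M_large n hn
  have h2 : (0 : ℝ) < D.L (n + 1) := by exact_mod_cast (hD.blocked_succ n).L_pos
  have h3 := (div_pos h2 (hε_pos (n + 1) (by omega))).trans h1
  exact_mod_cast h3

theorem isAction_and_measurePreserving (hD : IsConstruction μ S.toEquiv P ε D)
    (hS : MeasurePreserving S μ μ) (n : ℕ) :
    IsAction (D.action S.toEquiv n) ∧
      ∀ g, MeasurePreserving (D.action S.toEquiv n g) μ μ := by
  induction n with
  | zero => exact ⟨isAction_zpow _, measurePreserving_zpow S hS⟩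
  | succ n ih =>
    obtain ⟨e, ht⟩ := hD.exists_tower_succ n
    have hb := hD.blocked_succ n
    have hc := hb.isColumnScheme ih.1 ht
    exact ⟨hc.isAction_cocycleAction,
      hc.measurePreserving_cocycleAction ih.2 (hb.measurable_displacement ih.2 ht.1)⟩

theorem isAction (hD : IsConstruction μ S.toEquiv P ε D) (hS : MeasurePreserving S μ μ) (n : ℕ) :
    IsAction (D.action S.toEquiv n) :=
  (hD.isAction_and_measurePreserving hS n).1

theorem measurePreserving (hD : IsConstruction μ S.toEquiv P ε D) (hS : MeasurePreserving S μ μ)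
    (n : ℕ) (g : ℤ) : MeasurePreserving (D.action S.toEquiv n g) μ μ :=
  (hD.isAction_and_measurePreserving hS n).2 g

theorem measurableSet_agree [MeasurableEq X] (hD : IsConstruction μ S.toEquiv P ε D)
    (hS : MeasurePreserving S μ μ) (m n : ℕ) : MeasurableSet (D.agree S.toEquiv m n) :=
  measurableSet_eq_fun (hD.measurePreserving hS m 1).measurable
    (hD.measurePreserving hS n 1).measurable

/-! ### Summing the changes over the stages -/

theorem sum_Ico_ε_le (hε_lt : ∀ n ≥ 1, ε n < 1 / 2 ^ n) {m n : ℕ} (hmn : m ≤ n) :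
    ∑ t ∈ Finset.Ico m n, ε (t + 1) ≤ 1 / 2 ^ m := by
  suffices h : ∑ t ∈ Finset.Ico m n, ε (t + 1) ≤ 1 / 2 ^ m - 1 / 2 ^ n from
    h.trans (sub_le_self _ (by positivity))
  induction n, hmn using Nat.le_induction with
  | base => simp
  | succ n hn ih =>
    rw [Finset.sum_Ico_succ_top hn]
    have h1 := hε_lt (n + 1) (by omega)
    have h2 : (1 : ℝ) / 2 ^ n = 2 * (1 / 2 ^ (n + 1)) := by
      rw [pow_succ]; field_simp
    linarith

theorem measureReal_succ_ne_le [IsProbabilityMeasure μ]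
    (hD : IsConstruction μ S.toEquiv P ε D) (hS : MeasurePreserving S μ μ)
    (hε_pos : ∀ n ≥ 1, 0 < ε n) {j n : ℕ} (hj : 1 ≤ j) (h1 : D.idx j ≤ n)
    (h2 : n < D.idx (j + 1)) (ℓ : ℕ) :
    μ.real {x | D.action S.toEquiv (n + 1) ℓ x ≠ D.action S.toEquiv n ℓ x} ≤
      ε (n + 1) / (D.K (D.idx (j + 1)) : ℝ) ^ 2 + ((D.K (n + 1) : ℝ) + ℓ) / D.L (n + 1) :=
  (hD.blocked_succ n).measureReal_ne_le (hD.isAction hS n) (hD.measurePreserving hS n)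
    (hD.tower j hj n h1 h2) (hD.M_pos hε_pos (hj.trans ((hD.le_idx hj).trans h1))) ℓ

/-- Between consecutive distinguished stages the generator changes so little that even along a
stretch of `K_{n_{j+1}}` consecutive times a change is improbable. -/
theorem measureReal_agree_compl_le [IsProbabilityMeasure μ]
    (hD : IsConstruction μ S.toEquiv P ε D) (hS : MeasurePreserving S μ μ)
    (hε_pos : ∀ n ≥ 1, 0 < ε n) (hε_lt : ∀ n ≥ 1, ε n < 1 / 2 ^ n) {j n : ℕ} (hj : 1 ≤ j)
    (hn : n + 1 = D.idx (j + 1)) :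
    μ.real (D.agree S.toEquiv (D.idx j) n)ᶜ ≤
      3 / (D.K (n + 1) : ℝ) ^ 2 * (1 / 2 ^ D.idx j) := by
  have hle : D.idx j ≤ n := by have := hD.idx_lt j hj; omega
  have hKn : (1 : ℝ) ≤ D.K (n + 1) := by exact_mod_cast hD.K_pos (n + 1)
  calc μ.real (D.agree S.toEquiv (D.idx j) n)ᶜ
      ≤ ∑ t ∈ Finset.Ico (D.idx j) n,
        μ.real {x | D.action S.toEquiv (t + 1) 1 x ≠ D.action S.toEquiv t 1 x} :=
        D.measureReal_action_ne_le S.toEquiv 1 hle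
    _ ≤ ∑ t ∈ Finset.Ico (D.idx j) n, 3 / (D.K (n + 1) : ℝ) ^ 2 * ε (t + 1) := by
        refine Finset.sum_le_sum fun t ht => ?_
        rw [Finset.mem_Ico] at ht
        have hs := hD.measureReal_succ_ne_le hS hε_pos hj ht.1 (by omega) 1
        have hl := hD.L_large j hj t ht.1 (by omega)
        rw [← hn] at hs hl
        have hL : (0 : ℝ) < D.L (t + 1) := by exact_mod_cast (hD.blocked_succ t).L_pos
        have hKt : (D.K (t + 1) : ℝ) ≤ D.K (n + 1) := by
          exact_mod_cast D.K_mono (by omega : t + 1 ≤ n + 1)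
        rw [div_lt_iff₀ hL] at hl
        refine hs.trans ?_
        have : ((D.K (t + 1) : ℝ) + (1 : ℕ)) / D.L (t + 1) ≤
            2 * ε (t + 1) / (D.K (n + 1) : ℝ) ^ 2 := by
          rw [div_le_div_iff₀ hL (by positivity), Nat.cast_one]
          nlinarith [mul_le_mul_of_nonneg_right
            (by linarith : (D.K (t + 1) : ℝ) + 1 ≤ 2 * D.K (n + 1)) (sq_nonneg (D.K (n + 1) : ℝ))]
        calc _ ≤ ε (t + 1) / (D.K (n + 1) : ℝ) ^ 2 + 2 * ε (t + 1) / (D.K (n + 1) : ℝ) ^ 2 :=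
              add_le_add_right this _
          _ = 3 / (D.K (n + 1) : ℝ) ^ 2 * ε (t + 1) := by ring
    _ = 3 / (D.K (n + 1) : ℝ) ^ 2 * ∑ t ∈ Finset.Ico (D.idx j) n, ε (t + 1) :=
        (Finset.mul_sum _ _ _).symm
    _ ≤ _ := mul_le_mul_of_nonneg_left (sum_Ico_ε_le hε_lt hle) (by positivity)

/-- The stages after `m` hardly change the iterate of order `L_m`, whose size is negligible with
respect to all later block lengths. -/
theorem measureReal_persist_le [IsProbabilityMeasure μ]
    (hD : IsConstruction μ S.toEquiv P ε D) (hS : MeasurePreserving S μ μ)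
    (hε_pos : ∀ n ≥ 1, 0 < ε n) (hε_lt : ∀ n ≥ 1, ε n < 1 / 2 ^ n) {m n : ℕ} (hm : 1 ≤ m)
    (hmn : m ≤ n) :
    μ.real {x | D.action S.toEquiv m (D.L m) x ≠ D.action S.toEquiv n (D.L m) x} ≤
      3 * (1 / 2 ^ m) := by
  calc _ ≤ ∑ t ∈ Finset.Ico m n,
        μ.real {x | D.action S.toEquiv (t + 1) (D.L m) x ≠ D.action S.toEquiv t (D.L m) x} :=
        D.measureReal_action_ne_le S.toEquiv _ hmn
    _ ≤ ∑ t ∈ Finset.Ico m n, 3 * ε (t + 1) := by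
        refine Finset.sum_le_sum fun t ht => ?_
        rw [Finset.mem_Ico] at ht
        have ht1 : 1 ≤ t := hm.trans ht.1
        obtain ⟨j, hj, h1, h2⟩ := hD.exists_idx ht1
        refine (hD.measureReal_succ_ne_le hS hε_pos hj h1 h2 (D.L m)).trans ?_
        have hb := hD.blocked_succ t
        have hε := hε_pos (t + 1) (by omega)
        have hL : (0 : ℝ) < D.L (t + 1) := by exact_mod_cast hb.L_pos
        have hK1 : (1 : ℝ) ≤ D.K (t + 1) := by exact_mod_cast hD.K_pos (t + 1)
        have hKK : (D.K (t + 1) : ℝ) ≤ D.K (D.idx (j + 1)) := by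
          exact_mod_cast D.K_mono (by omega : t + 1 ≤ D.idx (j + 1))
        have hK : (1 : ℝ) ≤ (D.K (D.idx (j + 1)) : ℝ) := hK1.trans hKK
        have hA : ε (t + 1) / (D.K (D.idx (j + 1)) : ℝ) ^ 2 ≤ ε (t + 1) :=
          div_le_self hε.le (one_le_pow₀ hK)
        have hB : (D.K (t + 1) : ℝ) / D.L (t + 1) ≤ ε (t + 1) := by
          refine le_trans ?_ (hD.L_large j hj t h1 h2).le
          gcongr
          exact hKK.trans (le_self_pow₀ hK (by norm_num))
        have hC : (D.L m : ℝ) / D.L (t + 1) ≤ ε (t + 1) := by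
          have hd : (0 : ℝ) < (D.L (t + 1) : ℝ) - D.K (t + 1) := by
            have : (D.K (t + 1) : ℝ) < D.L (t + 1) := by exact_mod_cast hb.K_lt_L
            linarith
          refine le_trans ?_ (hD.L_large' t ht1).le
          refine div_le_div₀ (by positivity) ?_ hd (by linarith)
          have := Finset.single_le_sum (f := fun i => (D.L i : ℝ)) (fun i _ => Nat.cast_nonneg _)
            (Finset.mem_Icc.mpr ⟨hm, ht.1⟩)
          have ht0 : (0 : ℝ) ≤ t := Nat.cast_nonneg _
          linarith
        rw [add_div]
        linarith
    _ = 3 * ∑ t ∈ Finset.Ico m n, ε (t + 1) := (Finset.mul_sum _ _ _).symm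
    _ ≤ _ := mul_le_mul_of_nonneg_left (sum_Ico_ε_le hε_lt hmn) (by norm_num)

end IsConstruction

/-! ### Independence of the choices in different blocks -/

section Uniform

variable {X : Type*} [MeasurableSpace X] {μ : Measure X} {D : Choices X} {n : ℕ}
  {T : ℤ → X → X} {ι : Type*} {f : X → ι}

theorem measurableSet_pureAtom (hT : ∀ g, Measurable (T g)) (hf : ∀ i, MeasurableSet (f ⁻¹' {i}))
    (M : ℕ) {B : Set X} (hB : MeasurableSet B) (b : X) : MeasurableSet (pureAtom T M B f b) := by
  have e : pureAtom T M B f b =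
      B ∩ ⋂ t ∈ Finset.Icc (1 : ℤ) M, T t ⁻¹' (f ⁻¹' {f (T t b)}) := by
    ext a
    simp [pureAtom]
  rw [e]
  exact hB.inter (Finset.measurableSet_biInter _ fun t _ => hT t (hf _))

theorem card_piFinset_two_fixed {Q K : ℕ} {u v : Fin Q} (huv : u ≠ v) (k k' : ℕ) :
    (Fintype.piFinset fun q : Fin Q => if q = u then {k} else if q = v then {k'} else
      Finset.Icc 1 K).card = K ^ (Q - 2) := by
  rw [Fintype.card_piFinset,
    ← Finset.prod_subset (Finset.subset_univ (Finset.univ \ {u, v} : Finset (Fin Q)))]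
  · rw [Finset.prod_congr rfl (g := fun _ => K), Finset.prod_const,
      Finset.card_sdiff_of_subset (Finset.subset_univ _), Finset.card_pair huv, Finset.card_univ,
      Fintype.card_fin]
    intro q hq
    simp only [Finset.mem_sdiff, Finset.mem_univ, true_and, Finset.mem_insert,
      Finset.mem_singleton, not_or] at hq
    rw [if_neg hq.1, if_neg hq.2, Nat.card_Icc, Nat.add_sub_cancel]
  · intro q _ hq
    simp only [Finset.mem_sdiff, Finset.mem_univ, true_and, Finset.mem_insert,
      Finset.mem_singleton, not_not] at hq
    rcases hq with rfl | rfl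
    · simp
    · simp [huv.symm]

/-- On one atom of the pure partition, the choices made in two different blocks are independent and
uniformly distributed. -/
theorem Choices.IsUniform.measureReal_pureAtom [IsFiniteMeasure μ] (hU : D.IsUniform μ T n f)
    (h : D.IsBlocked n)
    (hT : ∀ g, Measurable (T g)) (hf : ∀ i, MeasurableSet (f ⁻¹' {i}))
    (hB : MeasurableSet (D.B n)) {b : X} (hb : b ∈ D.B n) {u v : ℕ} (hu : u < D.M n / D.L n)
    (hv : v < D.M n / D.L n) (huv : u ≠ v) {k k' : ℕ} (hk : k ∈ Finset.Icc 1 (D.K n))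
    (hk' : k' ∈ Finset.Icc 1 (D.K n)) :
    μ.real {a ∈ pureAtom T (D.M n) (D.B n) f b | D.pick n a u = k ∧ D.pick n a v = k'} =
      μ.real (pureAtom T (D.M n) (D.B n) f b) / (D.K n : ℝ) ^ 2 := by
  set Q := D.M n / D.L n
  set A := pureAtom T (D.M n) (D.B n) f b
  have hAB : A ⊆ D.B n := fun a ha => ha.1
  have hAm : MeasurableSet A := measurableSet_pureAtom hT hf _ hB b
  let u' : Fin Q := ⟨u, hu⟩
  let v' : Fin Q := ⟨v, hv⟩
  have huv' : u' ≠ v' := fun e => huv (congrArg Fin.val e)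
  let F : Fin Q → Finset ℕ := fun q =>
    if q = u' then {k} else if q = v' then {k'} else Finset.Icc 1 (D.K n)
  let ext : (Fin Q → ℕ) → ℕ → ℕ := fun τ q => if hq : q < Q then τ ⟨q, hq⟩ else 0
  have hext : ∀ τ q (hq : q < Q), ext τ q = τ ⟨q, hq⟩ := fun τ q hq => dif_pos hq
  let Y : (Fin Q → ℕ) → Set X := fun τ => {a ∈ A | ∀ q < Q, D.pick n a q = ext τ q}
  have hset : {a ∈ A | D.pick n a u = k ∧ D.pick n a v = k'} =
      ⋃ τ ∈ Fintype.piFinset F, Y τ := by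
    ext a
    simp only [Set.mem_iUnion₂, Fintype.mem_piFinset, exists_prop]
    constructor
    · rintro ⟨ha, h1, h2⟩
      refine ⟨fun q => D.pick n a q, fun q => ?_, ha, fun q hq => (hext (fun q => D.pick n a q) q hq).symm⟩
      simp only [F]
      split_ifs with e1 e2
      · rw [e1, Finset.mem_singleton]; exact h1
      · rw [e2, Finset.mem_singleton]; exact h2
      · exact h.pick_mem a (hAB ha) q q.2
    · rintro ⟨τ, hτ, ha, hq⟩
      refine ⟨ha, ?_, ?_⟩
      · rw [hq u hu, hext _ u hu]
        simpa [F, u'] using hτ u'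
      · rw [hq v hv, hext _ v hv]
        simpa [F, v', huv'.symm] using hτ v'
  have hYm : ∀ τ, MeasurableSet (Y τ) := by
    intro τ
    have e : Y τ = A ∩ ⋂ q ∈ Finset.range Q, {a ∈ D.B n | D.pick n a q = ext τ q} := by
      ext a
      simp only [Y, Set.mem_ofPred_eq, Set.mem_inter_iff, Set.mem_iInter, Finset.mem_range]
      exact and_congr_right fun ha => forall₂_congr fun q hq =>
        (and_iff_right (hAB ha)).symm
    rw [e]
    exact hAm.inter (Finset.measurableSet_biInter _ fun q hq =>
      h.pick_measurable q (Finset.mem_range.mp hq) _)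
  have hYd : Set.PairwiseDisjoint (↑(Fintype.piFinset F)) Y := by
    intro τ _ τ' _ hne
    refine Set.disjoint_left.mpr fun a ha ha' => hne (funext fun q => ?_)
    have := (ha.2 q q.2).symm.trans (ha'.2 q q.2)
    rwa [hext _ _ q.2, hext _ _ q.2] at this
  have hYμ : ∀ τ ∈ Fintype.piFinset F, μ.real (Y τ) = μ.real A / (D.K n : ℝ) ^ Q := by
    intro τ hτ
    refine hU b hb (ext τ) fun q hq => ?_
    rw [hext _ q hq]
    have := Fintype.mem_piFinset.mp hτ ⟨q, hq⟩
    simp only [F] at this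
    split_ifs at this
    · rwa [Finset.mem_singleton.mp this]
    · rwa [Finset.mem_singleton.mp this]
    · exact this
  have hQ : Q = (Q - 2) + 2 := by omega
  have hK : (D.K n : ℝ) ≠ 0 := by
    have := Finset.mem_Icc.mp hk
    exact_mod_cast (by omega : D.K n ≠ 0)
  rw [hset, measureReal_biUnion_finset hYd fun τ _ => hYm τ, Finset.sum_congr rfl hYμ,
    Finset.sum_const, card_piFinset_two_fixed huv', nsmul_eq_mul]
  conv_lhs => rw [hQ, pow_add]
  push_cast
  field_simp

/-- On a set of columns that is determined by their names, the choices made in two different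
blocks are independent and uniformly distributed. -/
theorem Choices.IsUniform.measureReal_pick_pair [IsFiniteMeasure μ] [Finite ι]
    (hU : D.IsUniform μ T n f) (h : D.IsBlocked n)
    (hT : ∀ g, Measurable (T g)) (hf : ∀ i, MeasurableSet (f ⁻¹' {i}))
    (hB : MeasurableSet (D.B n)) {C : Set X} (hCB : C ⊆ D.B n)
    (hC : ∀ b ∈ C, ∀ b' ∈ D.B n,
      (∀ t ∈ Finset.Icc (1 : ℤ) (D.M n), f (T t b') = f (T t b)) → b' ∈ C)
    {u v : ℕ} (hu : u < D.M n / D.L n) (hv : v < D.M n / D.L n) (huv : u ≠ v) {k k' : ℕ}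
    (hk : k ∈ Finset.Icc 1 (D.K n)) (hk' : k' ∈ Finset.Icc 1 (D.K n)) :
    μ.real {b ∈ C | D.pick n b u = k ∧ D.pick n b v = k'} = μ.real C / (D.K n : ℝ) ^ 2 := by
  let F : X → (Finset.Icc (1 : ℤ) (D.M n) → ι) := fun x t => f (T t x)
  have := Fintype.ofFinite (Finset.Icc (1 : ℤ) (D.M n) → ι)
  have hF : ∀ N, MeasurableSet (F ⁻¹' {N}) := by
    intro N
    have e : F ⁻¹' {N} = ⋂ t : Finset.Icc (1 : ℤ) (D.M n), T (t : ℤ) ⁻¹' (f ⁻¹' {N t}) := by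
      ext x
      simp [F, funext_iff]
    rw [e]
    exact MeasurableSet.iInter fun t => hT _ (hf _)
  have hsum : ∀ Y : Set X, μ.real Y = ∑ N, μ.real (F ⁻¹' {N} ∩ Y) := by
    intro Y
    have := sum_measureReal_preimage_singleton (μ := μ.restrict Y) Finset.univ
      (f := F) fun N _ => hF N
    rw [Finset.coe_univ, Set.preimage_univ, measureReal_restrict_apply_univ] at this
    rw [← this]
    exact Finset.sum_congr rfl fun N _ => measureReal_restrict_apply (hF N)
  rw [hsum C, hsum, Finset.sum_div]
  refine Finset.sum_congr rfl fun N _ => ?_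
  rcases (F ⁻¹' {N} ∩ C).eq_empty_or_nonempty with he | ⟨b, hbN, hbC⟩
  · rw [he, Set.subset_empty_iff.mp ((Set.inter_subset_inter_right _ (Set.sep_subset _ _)).trans
      he.subset)]
    simp
  · have hmem : ∀ a, a ∈ pureAtom T (D.M n) (D.B n) f b ↔ a ∈ F ⁻¹' {N} ∧ a ∈ C := by
      intro a
      have hbN' : F b = N := hbN
      rw [Set.mem_preimage, Set.mem_singleton_iff, ← hbN']
      constructor
      · exact fun ha => ⟨funext fun t => ha.2 t t.2, hC b hbC a ha.1 ha.2⟩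
      · exact fun ha => ⟨hCB ha.2, fun t ht => congrFun ha.1 ⟨t, ht⟩⟩
    have e1 : F ⁻¹' {N} ∩ C = pureAtom T (D.M n) (D.B n) f b := by
      ext a; rw [hmem]; rfl
    have e2 : F ⁻¹' {N} ∩ {b ∈ C | D.pick n b u = k ∧ D.pick n b v = k'} =
        {a ∈ pureAtom T (D.M n) (D.B n) f b | D.pick n a u = k ∧ D.pick n a v = k'} := by
      ext a
      simp only [Set.mem_inter_iff, Set.mem_ofPred_eq, hmem]
      tauto
    rw [e1, e2]
    exact hU.measureReal_pureAtom h hT hf hB (hCB hbC) hu hv huv hk hk'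

end Uniform

/-! ### Averages over a window of the orbit -/

open Classical in
/-- If most points have a typical name over `F`, then a translate of `F` samples the cell `f = i`
independently of any given set `Y`, on average. -/
theorem abs_sum_measureReal_sub_le {X ι : Type*} [MeasurableSpace X] {μ : Measure X}
    [IsProbabilityMeasure μ] {T : ℤ → X → X} (hT : IsAction T)
    (hmp : ∀ g, MeasurePreserving (T g) μ μ) {f : X → ι} (hf : ∀ i, MeasurableSet (f ⁻¹' {i}))
    {F : Finset ℤ} (hF : F.Nonempty) {ε : ℝ} (hε : 0 ≤ ε) {Z : Set X} (hZ : MeasurableSet Z)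
    (hname : ∀ x ∉ Z, NameWithin μ T f F ε x) (Y : Set X) (g : ℤ) (i : ι) :
    |∑ v ∈ F, μ.real (Y ∩ T (v + g) ⁻¹' (f ⁻¹' {i})) -
      F.card * (μ.real Y * μ.real (f ⁻¹' {i}))| ≤ F.card * (ε + μ.real Z) := by
  have hc : (0 : ℝ) < F.card := by exact_mod_cast hF.card_pos
  have hm : ∀ v, MeasurableSet (T (v + g) ⁻¹' (f ⁻¹' {i})) := fun v => (hmp _).measurable (hf i)
  let φ : X → ℝ := fun x =>
    ∑ v ∈ F, (T (v + g) ⁻¹' (f ⁻¹' {i})).indicator (fun _ => (1 : ℝ)) x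
  have hφ : ∀ x, φ x = F.card * nameFreq T f F (T g x) i := by
    intro x
    rw [nameFreq, mul_div_cancel₀ _ hc.ne', Finset.card_filter, Nat.cast_sum]
    refine Finset.sum_congr rfl fun v _ => ?_
    simp [Set.indicator_apply, hT.add]
  have hbound : ∀ x, |φ x - F.card * μ.real (f ⁻¹' {i})| ≤
      F.card * (ε + (T g ⁻¹' Z).indicator (fun _ => (1 : ℝ)) x) := by
    intro x
    rw [hφ, ← mul_sub, abs_mul, abs_of_pos hc]
    refine mul_le_mul_of_nonneg_left ?_ hc.le
    by_cases hx : T g x ∈ Z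
    · rw [Set.indicator_of_mem (show x ∈ T g ⁻¹' Z from hx)]
      have h0 : 0 ≤ nameFreq T f F (T g x) i := by unfold nameFreq; positivity
      have h1 : nameFreq T f F (T g x) i ≤ 1 := by
        unfold nameFreq
        rw [div_le_one hc]
        exact_mod_cast Finset.card_filter_le _ _
      have h2 : 0 ≤ μ.real (f ⁻¹' {i}) := measureReal_nonneg
      have h3 : μ.real (f ⁻¹' {i}) ≤ 1 := measureReal_le_one
      rw [abs_le]
      constructor <;> linarith
    · rw [Set.indicator_of_notMem (show x ∉ T g ⁻¹' Z from hx), abs_sub_comm, add_zero]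
      exact (hname _ hx i).le
  have hint1 : ∀ s : Set X, MeasurableSet s →
      Integrable (s.indicator fun _ => (1 : ℝ)) (μ.restrict Y) :=
    fun s hs => (integrable_const 1).indicator hs
  have hφint : Integrable φ (μ.restrict Y) := integrable_finsetSum _ fun v _ => hint1 _ (hm v)
  have hind : ∀ s : Set X, MeasurableSet s →
      ∫ x in Y, s.indicator (fun _ => (1 : ℝ)) x ∂μ = μ.real (Y ∩ s) := by
    intro s hs
    rw [integral_indicator hs, setIntegral_const, smul_eq_mul, mul_one,
      measureReal_restrict_apply hs, Set.inter_comm]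
  have hsum : ∑ v ∈ F, μ.real (Y ∩ T (v + g) ⁻¹' (f ⁻¹' {i})) = ∫ x in Y, φ x ∂μ := by
    rw [integral_finsetSum _ fun v _ => hint1 _ (hm v)]
    exact Finset.sum_congr rfl fun v _ => (hind _ (hm v)).symm
  have hconst : ∀ c : ℝ, ∫ _ in Y, c ∂μ = μ.real Y * c := fun c => by
    rw [setIntegral_const, smul_eq_mul]
  have hZg : MeasurableSet (T g ⁻¹' Z) := (hmp g).measurable hZ
  rw [hsum, mul_left_comm, ← hconst, ← integral_sub hφint (integrable_const _)]
  calc _ ≤ ∫ x in Y, |φ x - F.card * μ.real (f ⁻¹' {i})| ∂μ := abs_integral_le_integral_abs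
    _ ≤ ∫ x in Y, F.card * (ε + (T g ⁻¹' Z).indicator (fun _ => (1 : ℝ)) x) ∂μ :=
        integral_mono (hφint.sub (integrable_const _)).abs
          (((integrable_const _).add (hint1 _ hZg)).const_mul _) hbound
    _ = F.card * (μ.real Y * ε + μ.real (Y ∩ T g ⁻¹' Z)) := by
        rw [integral_const_mul, integral_add (integrable_const _) (hint1 _ hZg), hconst,
          hind _ hZg]
    _ ≤ F.card * (ε + μ.real Z) := by
        refine mul_le_mul_of_nonneg_left (add_le_add ?_ ?_) hc.le
        · exact mul_le_of_le_one_left hε measureReal_le_one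
        · rw [← (hmp g).measureReal_preimage hZ.nullMeasurableSet]
          exact measureReal_mono Set.inter_subset_right

/-! ### Mixing at a distinguished stage -/

/-- The levels of the tower of stage `n` that lie in the bulk of a block other than the last one:
their positions in the block stay in the part that is translated rigidly when they are moved by at
most `K_n` in either direction. -/
noncomputable def Choices.bulkLevels {X : Type*} (D : Choices X) (n : ℕ) : Finset ℤ :=
  (Finset.Icc (1 : ℤ) (D.M n)).filter fun p => p ≤ (D.M n : ℤ) - D.L n ∧
    (D.K n : ℤ) ≤ (p - 1) % (D.L n : ℤ) + 1 ∧ (p - 1) % (D.L n : ℤ) + 1 ≤ (D.L n : ℤ) - 2 * D.K n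

section Mixing

variable {X : Type*} [MeasurableSpace X] {μ : Measure X} {D : Choices X} {n : ℕ}
  {T : ℤ → X → X} {e : ℝ}

theorem Choices.IsBlocked.exists_block_of_mem_bulkLevels (h : D.IsBlocked n) {p : ℤ}
    (hp : p ∈ D.bulkLevels n) :
    ∃ u : ℕ, u + 1 < D.M n / D.L n ∧ ∃ r : ℤ, 1 ≤ r ∧ (D.K n : ℤ) ≤ r ∧
      r ≤ (D.L n : ℤ) - 2 * D.K n ∧ p = u * D.L n + r := by
  obtain ⟨hp1, hp2, hp3, hp4⟩ := Finset.mem_filter.mp hp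
  rw [Finset.mem_Icc] at hp1
  obtain ⟨u, hu, r, hr, rfl⟩ := exists_block h.L_pos h.L_dvd_M hp1
  rw [(block_ediv_emod h.L_pos u hr).2, sub_add_cancel] at hp3 hp4
  refine ⟨u, ?_, r, hr.1, hp3, hp4, rfl⟩
  obtain ⟨Q, hQ⟩ := h.L_dvd_M
  rw [hQ, Nat.mul_div_cancel_left _ h.L_pos] at hu ⊢
  by_contra hc
  obtain rfl : Q = u + 1 := by omega
  rw [hQ] at hp2
  push_cast at hp2
  nlinarith [hr.1]

theorem Choices.IsBlocked.measureReal_bulkLevels_compl_le [IsProbabilityMeasure μ]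
    (h : D.IsBlocked n) (hT : IsAction T) (hmp : ∀ g, MeasurePreserving (T g) μ μ)
    (ht : IsTower μ T (D.M n) (D.B n) e) (hM : 0 < D.M n) :
    μ.real (⋃ p ∈ D.bulkLevels n, T p '' D.B n)ᶜ ≤
      e + (3 * (D.K n : ℝ) / D.L n + (D.L n : ℝ) / D.M n) := by
  let R : Finset ℤ := Finset.Icc (1 : ℤ) (D.K n) ∪
    Finset.Ioc ((D.L n : ℤ) - 2 * D.K n) (D.L n)
  have hR : R.card ≤ 3 * D.K n := by
    refine (Finset.card_union_le _ _).trans ?_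
    rw [Int.card_Icc, Int.card_Ioc]
    omega
  have hsub : Finset.Icc (1 : ℤ) (D.M n) \ D.bulkLevels n ⊆
      ((Finset.Icc (1 : ℤ) (D.M n)).filter fun p => (p - 1) % (D.L n : ℤ) + 1 ∈ R) ∪
        Finset.Ioc ((D.M n : ℤ) - D.L n) (D.M n) := by
    intro p hp
    rw [Finset.mem_sdiff] at hp
    by_contra hc
    rw [Finset.mem_union, not_or] at hc
    refine hp.2 (Finset.mem_filter.mpr ⟨hp.1, ?_⟩)
    have hp1 := Finset.mem_Icc.mp hp.1
    have hc1 : (p - 1) % (D.L n : ℤ) + 1 ∉ R := fun hm =>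
      hc.1 (Finset.mem_filter.mpr ⟨hp.1, hm⟩)
    have hc2 := hc.2
    have hL : (0 : ℤ) < D.L n := by exact_mod_cast h.L_pos
    have h0 := Int.emod_nonneg (p - 1) hL.ne'
    have h3 := Int.emod_lt_of_pos (p - 1) hL
    simp only [R, Finset.mem_union, Finset.mem_Icc, Finset.mem_Ioc] at hc1 hc2
    omega
  have hcard : (Finset.Icc (1 : ℤ) (D.M n) \ D.bulkLevels n).card ≤
      D.M n / D.L n * (3 * D.K n) + D.L n := by
    refine (Finset.card_le_card hsub).trans ((Finset.card_union_le _ _).trans ?_)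
    refine add_le_add ((card_filter_residue_le h.L_pos h.L_dvd_M R).trans
      (Nat.mul_le_mul_left _ hR)) ?_
    rw [Int.card_Ioc]
    omega
  refine (ht.measureReal_levels_compl_le hT hmp hM hcard).trans_eq ?_
  congr 1
  have hL0 : (D.L n : ℝ) ≠ 0 := by exact_mod_cast h.L_pos.ne'
  have hM0 : (D.M n : ℝ) ≠ 0 := by exact_mod_cast hM.ne'
  rw [Nat.cast_add, add_div, Nat.cast_mul, Nat.cast_div h.L_dvd_M hL0]
  push_cast
  field_simp

/-- From a bulk level, the rearranged action moves by one block length in the same way as the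
original action moves by `L + k - k'`, where `k`, `k'` are the translation numbers of the block and
of the next one. -/
theorem Choices.IsBlocked.cocycleAction_bulk (h : D.IsBlocked n) (hT : IsAction T)
    (ht : IsTower μ T (D.M n) (D.B n) e) {u : ℕ} (hu : u + 1 < D.M n / D.L n) {r : ℤ} (hr1 : 1 ≤ r)
    (hrK : (D.K n : ℤ) ≤ r) (hrL : r ≤ (D.L n : ℤ) - 2 * D.K n) {b : X} (hb : b ∈ D.B n) :
    cocycleAction T (towerCocycle T (D.M n) (D.B n) (D.σ n)) (D.L n) (T (u * D.L n + r) b) =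
      T (u * D.L n + r + (D.L n + D.pick n b u - D.pick n b (u + 1))) b := by
  have hk := Finset.mem_Icc.mp (h.pick_mem b hb u (by omega))
  have hk' := Finset.mem_Icc.mp (h.pick_mem b hb (u + 1) hu)
  have hr' : r + D.pick n b u - D.pick n b (u + 1) ∈
      Set.Icc (1 : ℤ) ((D.L n : ℤ) - D.K n) := ⟨by omega, by omega⟩
  have hcol := (h.isColumnScheme hT ht).cocycleAction_column hb
    (block_mem_Icc h.L_dvd_M (by omega : u < D.M n / D.L n) (r := r) ⟨hr1, by omega⟩)
    (block_mem_Icc h.L_dvd_M hu (r := r + D.pick n b u - D.pick n b (u + 1))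
      ⟨hr'.1, by linarith [hr'.2, Int.natCast_nonneg (D.K n)]⟩)
  rw [h.σ_apply hb hu hr', h.σ_apply hb (by omega) ⟨hr1, by omega⟩] at hcol
  convert hcol using 2
  · push_cast; ring
  · push_cast; ring

variable {ι : Type*} {f : X → ι}

/-- On a bulk level, the translation `L + k - k'` is distributed as if `k` and `k'` were chosen
uniformly and independently of the name. -/
theorem Choices.IsUniform.measureReal_level [IsFiniteMeasure μ] [Finite ι]
    (hU : D.IsUniform μ T n f) (h : D.IsBlocked n) (hT : IsAction T)
    (hmp : ∀ g, MeasurePreserving (T g) μ μ) (ht : IsTower μ T (D.M n) (D.B n) e)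
    (hf : ∀ U : Set ι, MeasurableSet (f ⁻¹' U)) {s : ℤ} (hs : s ∈ D.bulkLevels n) (U V : Set ι) :
    μ.real (T s '' D.B n ∩ (f ⁻¹' U ∩
        cocycleAction T (towerCocycle T (D.M n) (D.B n) (D.σ n)) (D.L n) ⁻¹' (f ⁻¹' V))) =
      ∑ k ∈ Finset.Icc 1 (D.K n), ∑ k' ∈ Finset.Icc 1 (D.K n),
        μ.real (T s '' D.B n ∩ (f ⁻¹' U ∩ T ((D.L n : ℤ) + k - k') ⁻¹' (f ⁻¹' V))) /
          (D.K n : ℝ) ^ 2 := by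
  set T' := cocycleAction T (towerCocycle T (D.M n) (D.B n) (D.σ n))
  have hB : MeasurableSet (D.B n) := ht.1
  have hTm : ∀ g, Measurable (T g) := fun g => (hmp g).measurable
  obtain ⟨u, hu, r, hr1, hrK, hrL, rfl⟩ := h.exists_block_of_mem_bulkLevels hs
  have hbulk : ∀ b ∈ D.B n, T' (D.L n) (T (u * D.L n + r) b) =
      T (u * D.L n + r + (D.L n + D.pick n b u - D.pick n b (u + 1))) b := fun b hb =>
    h.cocycleAction_bulk hT ht hu hr1 hrK hrL hb
  set s : ℤ := u * D.L n + r with hsdef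
  -- columns whose level `s` lies in `U` and whose level `s + L + k - k'` lies in `V`
  let C : ℕ × ℕ → Set X := fun κ =>
    {b ∈ D.B n | f (T s b) ∈ U ∧ f (T (s + ((D.L n : ℤ) + κ.1 - κ.2)) b) ∈ V}
  let Y : ℕ × ℕ → Set X := fun κ => {b ∈ C κ | D.pick n b u = κ.1 ∧ D.pick n b (u + 1) = κ.2}
  have hCm : ∀ κ, MeasurableSet (C κ) := fun κ =>
    hB.inter ((hTm _ (hf U)).inter (hTm _ (hf V)))
  have hYm : ∀ κ, MeasurableSet (Y κ) := by
    intro κ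
    have e1 : Y κ = C κ ∩ ({b ∈ D.B n | D.pick n b u = κ.1} ∩
        {b ∈ D.B n | D.pick n b (u + 1) = κ.2}) := by
      ext b
      simp only [Y, C, Set.mem_ofPred_eq, Set.mem_inter_iff]
      tauto
    rw [e1]
    exact (hCm κ).inter ((h.pick_measurable u (by omega) _).inter (h.pick_measurable (u + 1) hu _))
  have hset : T s '' D.B n ∩ (f ⁻¹' U ∩ T' (D.L n) ⁻¹' (f ⁻¹' V)) =
      ⋃ κ ∈ Finset.Icc 1 (D.K n) ×ˢ Finset.Icc 1 (D.K n), T s '' Y κ := by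
    ext x
    simp only [Set.mem_iUnion₂, exists_prop]
    constructor
    · rintro ⟨⟨b, hb, rfl⟩, h1, h2⟩
      rw [Set.mem_preimage, hbulk b hb] at h2
      exact ⟨(D.pick n b u, D.pick n b (u + 1)), Finset.mem_product.mpr
        ⟨h.pick_mem b hb u (by omega), h.pick_mem b hb (u + 1) hu⟩, b, ⟨⟨hb, h1, h2⟩, rfl, rfl⟩, rfl⟩
    · rintro ⟨κ, -, b, ⟨⟨hb, h1, h2⟩, h3, h4⟩, rfl⟩
      refine ⟨⟨b, hb, rfl⟩, h1, ?_⟩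
      rw [Set.mem_preimage, hbulk b hb, h3, h4]
      exact h2
  have hYd : Set.PairwiseDisjoint
      (↑(Finset.Icc 1 (D.K n) ×ˢ Finset.Icc 1 (D.K n))) fun κ => T s '' Y κ := by
    intro κ _ κ' _ hne
    refine (Set.disjoint_image_iff (hT.injective s)).mpr (Set.disjoint_left.mpr fun b hb hb' => ?_)
    exact hne (Prod.ext (hb.2.1.symm.trans hb'.2.1) (hb.2.2.symm.trans hb'.2.2))
  rw [hset, measureReal_biUnion_finset hYd fun κ _ => hT.measurableSet_image hmp s (hYm κ),
    Finset.sum_product]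
  refine Finset.sum_congr rfl fun k hk => Finset.sum_congr rfl fun k' hk' => ?_
  have hk1 := Finset.mem_Icc.mp hk
  have hk1' := Finset.mem_Icc.mp hk'
  have hmem_s : s ∈ Finset.Icc (1 : ℤ) (D.M n) := Finset.mem_Icc.mpr
    (block_mem_Icc h.L_dvd_M (by omega : u < D.M n / D.L n) (r := r) ⟨hr1, by omega⟩)
  have hmem_t : s + ((D.L n : ℤ) + k - k') ∈ Finset.Icc (1 : ℤ) (D.M n) := by
    have := block_mem_Icc h.L_dvd_M hu (r := r + k - k') ⟨by omega, by omega⟩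
    rw [Finset.mem_Icc]
    convert this using 1
    rw [hsdef]; push_cast
    constructor <;> rintro ⟨_, _⟩ <;> constructor <;> linarith
  have himage : T s '' C (k, k') =
      T s '' D.B n ∩ (f ⁻¹' U ∩ T ((D.L n : ℤ) + k - k') ⁻¹' (f ⁻¹' V)) := by
    ext x
    constructor
    · rintro ⟨b, ⟨hb, h1, h2⟩, rfl⟩
      rw [add_comm s, hT.add] at h2
      exact ⟨⟨b, hb, rfl⟩, h1, h2⟩
    · rintro ⟨⟨b, hb, rfl⟩, h1, h2⟩
      rw [Set.mem_preimage, ← hT.add, add_comm _ s] at h2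
      exact ⟨b, ⟨hb, h1, h2⟩, rfl⟩
  rw [← himage, hT.measureReal_image hmp s (hCm _), hT.measureReal_image hmp s (hYm _)]
  refine hU.measureReal_pick_pair h hTm (fun i => hf {i}) hB (fun b hb => hb.1) ?_ (by omega) hu
    (by omega) hk hk'
  rintro b ⟨_, h1, h2⟩ b' hb' hn
  refine ⟨hb', ?_, ?_⟩
  · rw [hn s hmem_s]; exact h1
  · rw [hn _ hmem_t]; exact h2

/-- After the rearrangement, the step of length `L` from a bulk level lands at a uniformly
distributed place of a window of length `K` of the original orbit, which most often has a typical
name. -/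
theorem Choices.IsUniform.abs_measureReal_sub_le [IsProbabilityMeasure μ] [Finite ι]
    (hU : D.IsUniform μ T n f) (h : D.IsBlocked n) (hT : IsAction T)
    (hmp : ∀ g, MeasurePreserving (T g) μ μ) (ht : IsTower μ T (D.M n) (D.B n) e)
    (hM : 0 < D.M n) (hK : 0 < D.K n) (hf : ∀ U : Set ι, MeasurableSet (f ⁻¹' U))
    (hT' : Measurable (cocycleAction T (towerCocycle T (D.M n) (D.B n) (D.σ n)) (D.L n)))
    {κ : Type*} {P : X → κ} {φ : ι → κ} (hP : P = φ ∘ f) {ε : ℝ} (hε : 0 ≤ ε)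
    {Z : Set X} (hZ : MeasurableSet Z)
    (hname : ∀ x ∉ Z, NameWithin μ T P (Finset.Icc (-(D.K n : ℤ)) (-1)) ε x) (p q : κ) :
    |μ.real (P ⁻¹' {p} ∩
        cocycleAction T (towerCocycle T (D.M n) (D.B n) (D.σ n)) (D.L n) ⁻¹' (P ⁻¹' {q})) -
      μ.real (P ⁻¹' {p}) * μ.real (P ⁻¹' {q})| ≤
      ε + μ.real Z + 2 * (e + (3 * (D.K n : ℝ) / D.L n + (D.L n : ℝ) / D.M n)) := by
  set T' := cocycleAction T (towerCocycle T (D.M n) (D.B n) (D.σ n))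
  set W : Set X := ⋃ s ∈ D.bulkLevels n, T s '' D.B n
  have hWc := h.measureReal_bulkLevels_compl_le hT hmp ht hM
  set w : ℝ := e + (3 * (D.K n : ℝ) / D.L n + (D.L n : ℝ) / D.M n)
  have hPpre : ∀ c, P ⁻¹' {c} = f ⁻¹' (φ ⁻¹' {c}) := fun c => by rw [hP]; rfl
  have hPm : ∀ c, MeasurableSet (P ⁻¹' {c}) := fun c => by rw [hPpre]; exact hf _
  have hTm : ∀ g, Measurable (T g) := fun g => (hmp g).measurable
  have hlev : ∀ s, MeasurableSet (T s '' D.B n) := fun s => hT.measurableSet_image hmp s ht.1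
  have hsum : ∀ A : Set X, MeasurableSet A →
      μ.real (W ∩ A) = ∑ s ∈ D.bulkLevels n, μ.real (T s '' D.B n ∩ A) := by
    intro A hA
    rw [Set.iUnion₂_inter, measureReal_biUnion_finset _ fun s _ => (hlev s).inter hA]
    intro s hs s' hs' hne
    exact (ht.2.1 (Finset.mem_Icc.mp (Finset.mem_filter.mp hs).1)
      (Finset.mem_Icc.mp (Finset.mem_filter.mp hs').1) hne).mono
        Set.inter_subset_left Set.inter_subset_left
  have hWm : MeasurableSet W := Finset.measurableSet_biUnion _ fun s _ => hlev s
  have hcut : ∀ A : Set X, |μ.real A - μ.real (W ∩ A)| ≤ w := by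
    intro A
    have h1 : μ.real (W ∩ A) ≤ μ.real A := measureReal_mono Set.inter_subset_right
    have h2 : μ.real A ≤ μ.real (W ∩ A) + μ.real Wᶜ := by
      refine (measureReal_mono fun x hx => ?_).trans (measureReal_union_le _ _)
      by_cases hxW : x ∈ W
      · exact Or.inl ⟨hxW, hx⟩
      · exact Or.inr hxW
    rw [abs_of_nonneg (sub_nonneg.mpr h1)]
    linarith
  have hKpos : (0 : ℝ) < D.K n := by exact_mod_cast hK
  -- the exact distribution over the bulk, as an average over `k` and `k'`
  have hexact : μ.real (W ∩ (P ⁻¹' {p} ∩ T' (D.L n) ⁻¹' (P ⁻¹' {q}))) =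
      ∑ k ∈ Finset.Icc 1 (D.K n), (∑ k' ∈ Finset.Icc 1 (D.K n),
        μ.real (W ∩ (P ⁻¹' {p} ∩ T ((D.L n : ℤ) + k - k') ⁻¹' (P ⁻¹' {q})))) /
          (D.K n : ℝ) ^ 2 := by
    rw [hsum _ ((hPm p).inter (hT' (hPm q)))]
    simp only [hPpre]
    rw [Finset.sum_congr rfl fun s hs => hU.measureReal_level h hT hmp ht hf hs _ _,
      Finset.sum_comm]
    refine Finset.sum_congr rfl fun k _ => ?_
    rw [Finset.sum_comm, Finset.sum_div]
    refine Finset.sum_congr rfl fun k' _ => ?_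
    rw [← Finset.sum_div, hsum _ ((hf _).inter (hTm _ (hf _)))]
  have hcardF : (Finset.Icc (-(D.K n : ℤ)) (-1)).card = D.K n := by
    rw [Int.card_Icc]; omega
  have hwindow : ∀ k : ℕ, |(∑ k' ∈ Finset.Icc 1 (D.K n),
        μ.real (W ∩ (P ⁻¹' {p} ∩ T ((D.L n : ℤ) + k - k') ⁻¹' (P ⁻¹' {q})))) -
      D.K n * (μ.real (W ∩ P ⁻¹' {p}) * μ.real (P ⁻¹' {q}))| ≤ D.K n * (ε + μ.real Z) := by
    intro k
    have := abs_sum_measureReal_sub_le hT hmp hPm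
      (Finset.card_pos.mp (by rw [hcardF]; exact hK)) hε hZ hname (W ∩ P ⁻¹' {p})
      ((D.L n : ℤ) + k) q
    rw [hcardF] at this
    convert this using 3
    refine Finset.sum_bij' (fun k' _ => -(k' : ℤ)) (fun v _ => (-v).toNat) ?_ ?_ ?_ ?_ ?_
    · intro k' hk'
      rw [Finset.mem_Icc] at hk' ⊢
      omega
    · intro v hv
      rw [Finset.mem_Icc] at hv ⊢
      omega
    · intro k' _
      simp
    · intro v hv
      rw [Finset.mem_Icc] at hv
      omega
    · intro k' _
      rw [Set.inter_assoc, sub_eq_neg_add]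
  have hbulk : |μ.real (W ∩ (P ⁻¹' {p} ∩ T' (D.L n) ⁻¹' (P ⁻¹' {q}))) -
      μ.real (W ∩ P ⁻¹' {p}) * μ.real (P ⁻¹' {q})| ≤ ε + μ.real Z := by
    set c := μ.real (W ∩ P ⁻¹' {p}) * μ.real (P ⁻¹' {q})
    have e1 : c = ∑ k ∈ Finset.Icc 1 (D.K n), D.K n * c / (D.K n : ℝ) ^ 2 := by
      rw [Finset.sum_const, Nat.card_Icc, Nat.add_sub_cancel, nsmul_eq_mul]
      field_simp
    rw [hexact, e1, ← Finset.sum_sub_distrib]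
    refine (Finset.abs_sum_le_sum_abs _ _).trans ?_
    have e2 : ε + μ.real Z =
        ∑ k ∈ Finset.Icc 1 (D.K n), D.K n * (ε + μ.real Z) / (D.K n : ℝ) ^ 2 := by
      rw [Finset.sum_const, Nat.card_Icc, Nat.add_sub_cancel, nsmul_eq_mul]
      field_simp
    rw [e2]
    refine Finset.sum_le_sum fun k _ => ?_
    rw [← sub_div, abs_div, abs_of_pos (pow_pos hKpos 2)]
    exact div_le_div_of_nonneg_right (hwindow k) (by positivity)
  have h1 := abs_le.mp (hcut (P ⁻¹' {p} ∩ T' (D.L n) ⁻¹' (P ⁻¹' {q})))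
  have h2 : |μ.real (P ⁻¹' {p}) * μ.real (P ⁻¹' {q}) -
      μ.real (W ∩ P ⁻¹' {p}) * μ.real (P ⁻¹' {q})| ≤ w := by
    rw [← sub_mul, abs_mul, abs_of_nonneg (measureReal_nonneg (s := P ⁻¹' {q}))]
    exact (mul_le_of_le_one_right (abs_nonneg _) measureReal_le_one).trans (hcut _)
  have h3 := abs_le.mp h2
  have h4 := abs_le.mp hbulk
  rw [abs_le]
  constructor <;> linarith

end Mixing

open Classical in
theorem nameFreq_congr {X ι : Type*} {T T' : ℤ → X → X} {f : X → ι} {F : Finset ℤ} {x : X} {i : ι}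
    (h : ∀ v ∈ F, T v x = T' v x) : nameFreq T f F x i = nameFreq T' f F x i := by
  unfold nameFreq
  congr 3
  exact Finset.filter_congr fun v hv => by rw [h v hv]

namespace IsConstruction

variable {X : Type*} [MeasurableSpace X] {μ : Measure X} {S : X ≃ᵐ X}
  {r : ℕ → ℕ} {P : (n : ℕ) → X → Fin (r n)} {ε : ℕ → ℝ} {D : Choices X}

/-- Off a small set, the names of `S_n`, where `n + 1 = n_{j+1}`, over the window `-C_K` agree with
those of `S_{n_j}` and are typical. -/
theorem exists_typical_names [MeasurableEq X] [IsProbabilityMeasure μ]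
    (hD : IsConstruction μ S.toEquiv P ε D) (hS : MeasurePreserving S μ μ)
    (hε_pos : ∀ n ≥ 1, 0 < ε n) (hε_lt : ∀ n ≥ 1, ε n < 1 / 2 ^ n) {j n : ℕ} (hj : 1 ≤ j)
    (hn : n + 1 = D.idx (j + 1)) :
    ∃ Z : Set X, MeasurableSet Z ∧ μ.real Z ≤ ε (j + 1) + 3 * (1 / 2 ^ D.idx j) ∧
      ∀ x ∉ Z, NameWithin μ (D.action S.toEquiv n) (P (j + 1))
        (Finset.Icc (-(D.K (n + 1) : ℤ)) (-1)) (ε (j + 1)) x := by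
  obtain ⟨hEm, hEμ, hE⟩ := hD.typical j hj
  have hO := hD.measureReal_agree_compl_le hS hε_pos hε_lt hj hn
  rw [← hn] at hE
  set m := D.idx j
  set K := D.K (n + 1)
  have hOm := (hD.measurableSet_agree hS m n).compl
  set O := D.agree S.toEquiv m n with hOdef
  have hact := hD.isAction hS n
  have hmp := hD.measurePreserving hS n
  have hKpos : (1 : ℝ) ≤ K := by exact_mod_cast hD.K_pos (n + 1)
  refine ⟨(D.E (j + 1))ᶜ ∪ ⋃ v ∈ Finset.Icc (-(K : ℤ)) (-1), D.action S.toEquiv n v ⁻¹' Oᶜ,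
    hEm.compl.union (Finset.measurableSet_biUnion _ fun v _ => (hmp v).measurable hOm), ?_, ?_⟩
  · refine (measureReal_union_le _ _).trans (add_le_add hEμ.le ?_)
    refine (measureReal_biUnion_finset_le _ _).trans ?_
    simp only [(hmp _).measureReal_preimage hOm.nullMeasurableSet]
    rw [Finset.sum_const, nsmul_eq_mul, Int.card_Icc,
      show ((-1 : ℤ) + 1 - -(K : ℤ)).toNat = K by omega]
    calc (K : ℝ) * μ.real Oᶜ ≤ K * (3 / (K : ℝ) ^ 2 * (1 / 2 ^ m)) :=
          mul_le_mul_of_nonneg_left hO (by positivity)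
      _ = 3 * (1 / 2 ^ m) / K := by field_simp
      _ ≤ 3 * (1 / 2 ^ m) := div_le_self (by positivity) hKpos
  · intro x hx
    rw [Set.mem_union, not_or, Set.notMem_compl_iff] at hx
    -- the two actions agree step by step into the past
    have key : ∀ v : ℕ, v ≤ K → D.action S.toEquiv m (-(v : ℤ)) x =
        D.action S.toEquiv n (-(v : ℤ)) x := by
      intro v
      induction v with
      | zero => intro _; simp [hact.zero, (hD.isAction hS m).zero]
      | succ v ih =>
        intro hv
        have hmem : D.action S.toEquiv n (-((v + 1 : ℕ) : ℤ)) x ∈ O := by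
          by_contra hc
          exact hx.2 (Set.mem_iUnion₂.mpr ⟨_, Finset.mem_Icc.mpr ⟨by omega, by omega⟩, hc⟩)
        have h1 : D.action S.toEquiv m 1 (D.action S.toEquiv n (-((v + 1 : ℕ) : ℤ)) x) =
            D.action S.toEquiv n 1 (D.action S.toEquiv n (-((v + 1 : ℕ) : ℤ)) x) := hmem
        rw [← hact.add, show (1 : ℤ) + -((v + 1 : ℕ) : ℤ) = -(v : ℤ) by push_cast; ring,
          ← ih (by omega)] at h1
        rw [← (hD.isAction hS m).neg_apply 1 (D.action S.toEquiv n (-((v + 1 : ℕ) : ℤ)) x), h1,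
          ← (hD.isAction hS m).add]
        congr 1
        push_cast; ring
    have hfreq : ∀ i, nameFreq (D.action S.toEquiv n) (P (j + 1)) (Finset.Icc (-(K : ℤ)) (-1)) x i =
        nameFreq (D.action S.toEquiv m) (P (j + 1)) (Finset.Icc (-(K : ℤ)) (-1)) x i := by
      intro i
      refine nameFreq_congr fun v hv => ?_
      rw [Finset.mem_Icc] at hv
      have := key (-v).toNat (by omega)
      rw [show -((-v).toNat : ℤ) = v by omega] at this
      exact this.symm
    intro i
    rw [hfreq]
    exact hE x hx.1 i

/-- The action of a distinguished stage `n_i`, `i > 1`, is nearly mixing at time `L_{n_i}`. -/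
theorem abs_mixing_idx_le [MeasurableEq X] [IsProbabilityMeasure μ]
    (hD : IsConstruction μ S.toEquiv P ε D) (hS : MeasurePreserving S μ μ)
    (hP_meas : ∀ n ≥ 1, Measurable (P n))
    (hε_pos : ∀ n ≥ 1, 0 < ε n) (hε_lt : ∀ n ≥ 1, ε n < 1 / 2 ^ n) {i : ℕ} (hi : 1 < i)
    (p q : Fin (r i)) :
    |μ.real (P i ⁻¹' {p} ∩
        D.action S.toEquiv (D.idx i) (D.L (D.idx i)) ⁻¹' (P i ⁻¹' {q})) -
      μ.real (P i ⁻¹' {p}) * μ.real (P i ⁻¹' {q})| ≤ 18 / 2 ^ i := by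
  obtain ⟨j, rfl⟩ : ∃ j, i = j + 1 := ⟨i - 1, by omega⟩
  have hj : 1 ≤ j := by omega
  have hlt := hD.idx_lt j hj
  obtain ⟨n, hn⟩ : ∃ n, n + 1 = D.idx (j + 1) := ⟨D.idx (j + 1) - 1, by omega⟩
  have hjm : j ≤ D.idx j := hD.le_idx hj
  have hn1 : 1 ≤ n := by omega
  obtain ⟨Z, hZm, hZμ, hZ⟩ := hD.exists_typical_names hS hε_pos hε_lt hj hn
  have hact := hD.isAction hS n
  have hmp := hD.measurePreserving hS n
  have hb := hD.blocked_succ n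
  have ht := hD.tower j hj n (by omega) (by omega)
  have hO := hD.measurableSet_agree hS (D.idx j) n
  have hL := hD.L_large j hj n (by omega) (by omega)
  rw [← hn] at ht hL ⊢
  have hf : Measurable fun x => (P (j + 1) x, x ∈ D.agree S.toEquiv (D.idx j) n) :=
    (hP_meas (j + 1) (by omega)).prodMk (measurable_mem.mpr hO)
  have hmain := (hD.uniform j hj n hn).abs_measureReal_sub_le hb hact hmp ht (hD.M_pos hε_pos hn1)
    (hD.K_pos _) (fun U => hf (MeasurableSet.of_discrete (s := U)))
    (hD.measurePreserving hS (n + 1) _).measurable (φ := Prod.fst) rfl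
    (hε_pos (j + 1) (by omega)).le hZm hZ p q
  refine le_trans hmain ?_
  have hε := hε_pos (n + 1) (by omega)
  have hK : (1 : ℝ) ≤ D.K (n + 1) := by exact_mod_cast hD.K_pos (n + 1)
  have hLpos : (0 : ℝ) < D.L (n + 1) := by exact_mod_cast hb.L_pos
  have hA : ε (n + 1) / (D.K (n + 1) : ℝ) ^ 2 ≤ ε (n + 1) := div_le_self hε.le (one_le_pow₀ hK)
  have hB : 3 * (D.K (n + 1) : ℝ) / D.L (n + 1) ≤ 3 * ε (n + 1) := by
    rw [mul_div_assoc]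
    refine mul_le_mul_of_nonneg_left (le_trans ?_ hL.le) (by norm_num)
    gcongr
    exact le_self_pow₀ hK (by norm_num)
  have hC : (D.L (n + 1) : ℝ) / D.M (n + 1) ≤ ε (n + 1) := by
    have hMl := hD.M_large n hn1
    have hMpos : (0 : ℝ) < D.M (n + 1) := by exact_mod_cast hD.M_pos hε_pos hn1
    rw [div_lt_iff₀ hε] at hMl
    rw [div_le_iff₀ hMpos]
    linarith
  have hpow : ∀ {a b : ℕ}, a ≤ b → (1 : ℝ) / 2 ^ b ≤ 1 / 2 ^ a := fun hab =>
    one_div_le_one_div_of_le (by positivity) (pow_le_pow_right₀ (by norm_num) hab)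
  have e1 : ε (n + 1) ≤ 1 / 2 ^ (j + 1) :=
    (hε_lt _ (by omega)).le.trans (hpow (by omega))
  have e2 : ε (j + 1) ≤ 1 / 2 ^ (j + 1) := (hε_lt _ (by omega)).le
  have e3 : (1 : ℝ) / 2 ^ D.idx j ≤ 2 * (1 / 2 ^ (j + 1)) :=
    (hpow hjm).trans_eq (by rw [pow_succ]; field_simp)
  have e4 : (18 : ℝ) / 2 ^ (j + 1) = 18 * (1 / 2 ^ (j + 1)) := by ring
  rw [e4]
  linarith

end IsConstruction

end Staggered

theorem proposition7p17 {X : Type*} [MeasurableSpace X] [StandardBorelSpace X]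
    (μ : Measure X) [IsProbabilityMeasure μ] [NullSingletonClass μ]
    (S : X ≃ᵐ X) (hS : Ergodic S μ)
    {r : ℕ → ℕ} (P : (n : ℕ) → X → Fin (r n))
    (hP_meas : ∀ n ≥ 1, Measurable (P n))
    (hP_refine : ∀ n ≥ 1, ∃ f : Fin (r (n + 1)) → Fin (r n), P n = f ∘ P (n + 1))
    (hP_gen : ∀ A : Set X, MeasurableSet A → ∃ A' : Set X,
      MeasurableSet[⨆ n : ℕ, MeasurableSpace.comap (P (n + 1)) ⊤] A' ∧ A =ᵐ[μ] A')
    (ε : ℕ → ℝ) (hε_pos : ∀ n ≥ 1, 0 < ε n) (hε_anti : ∀ n ≥ 1, ε (n + 1) < ε n)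
    (hε_lt : ∀ n ≥ 1, ε n < 1 / 2 ^ n)
    (D : Staggered.Choices X) (hD : Staggered.IsConstruction μ S.toEquiv P ε D) :
    ∃ δ : ℕ → ℝ, (∀ i, 0 ≤ δ i) ∧ Tendsto δ atTop (𝓝 0) ∧
      ∀ i > 1, ∀ j ≥ i,
        Staggered.IsMixingRel μ (D.action S.toEquiv (D.idx j)) (δ i) (D.L (D.idx i)) (P i) := by
  have hmp := hS.toMeasurePreserving
  refine ⟨fun i => 32 * (1 / 2) ^ i, fun i => by positivity, ?_, ?_⟩
  · simpa using (tendsto_pow_atTop_nhds_zero_of_lt_one (r := (1 / 2 : ℝ)) (by norm_num)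
      (by norm_num)).const_mul 32
  intro i hi j hj p q
  have hmix := hD.abs_mixing_idx_le hmp hP_meas hε_pos hε_lt hi p q
  have hpers := hD.measureReal_persist_le hmp hε_pos hε_lt (m := D.idx i) (n := D.idx j)
    (hi.le.trans (hD.le_idx hi.le)) (hD.idx_mono hi.le hj)
  have hPm : ∀ c, MeasurableSet (P i ⁻¹' {c}) := fun c =>
    hP_meas i hi.le (measurableSet_singleton c)
  have hset : ∀ m, MeasurableSet (P i ⁻¹' {p} ∩
      D.action S.toEquiv m (D.L (D.idx i)) ⁻¹' (P i ⁻¹' {q})) := fun m =>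
    (hPm p).inter ((hD.measurePreserving hmp m _).measurable (hPm q))
  have hdiff := (abs_measureReal_sub_le_measureReal_symmDiff
    (hset (D.idx j)).nullMeasurableSet (hset (D.idx i)).nullMeasurableSet (μ := μ)).trans
    ((measureReal_mono (s₂ := {x | D.action S.toEquiv (D.idx i) (D.L (D.idx i)) x ≠
      D.action S.toEquiv (D.idx j) (D.L (D.idx i)) x}) fun x hx => ?_).trans hpers)
  · have hpow : (1 : ℝ) / 2 ^ D.idx i ≤ 1 / 2 ^ i :=
      one_div_le_one_div_of_le (by positivity) (pow_le_pow_right₀ (by norm_num) (hD.le_idx hi.le))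
    have hpos : (0 : ℝ) < 1 / 2 ^ i := by positivity
    have e1 : (32 : ℝ) * (1 / 2) ^ i = 32 * (1 / 2 ^ i) := by rw [one_div_pow]
    have e2 : (18 : ℝ) / 2 ^ i = 18 * (1 / 2 ^ i) := by ring
    rw [e2] at hmix
    have h1 := abs_le.mp hmix
    have h2 := abs_le.mp hdiff
    dsimp only
    rw [e1, abs_lt]
    constructor <;> linarith
  · intro heq
    rw [Set.mem_symmDiff] at hx
    simp only [Set.mem_inter_iff, Set.mem_preimage, heq] at hx
    tauto
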